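/- Let $\mathcal{D}$ be a class of finite groups and, for $G,H\in\mathcal{D}$, let $\mathcal{S}_{G,H}$ be a set of subgroups $L\le G\times H$ with $k_1(L)=\{g\in G\mid (g,1)\in L\}=1$. Assume that the sets $\mathcal{S}_{G,H}$ are closed under $G\times H$-conjugation and under taking subgroups, that $L*M\in\mathcal{S}_{G,K}$ for all $L\in\mathcal{S}_{G,H}$ and $M\in\mathcal{S}_{H,K}$, where $L*M=\{(g,k)\mid \exists h\in H: (g,h)\in L,\ (h,k)\in M\}$, and that the diagonal subgroup of $G\times G$ belongs to $\mathcal{S}_{G,G}$ for all $G\in\mathcal{D}$. Let $\Delta(\mathcal{S})_{G,H}$ be the set of those $L\in\mathcal{S}_{G,H}$ which also satisfy $k_2(L)=\{h\in H\mid (1,h)\in L\}=1$. Let $B(G,G)$ be the double Burnside ring of $G\in\mathcal{D}$, i.e. the Grothendieck ring of finite $(G,G)$-bisets with respect to disjoint union and the product $[X]\cdot[Y]=[X\times_G Y]$, and let $B^{\mathcal{S}}(G,G)$ be the subring spanned by the classes $[(G\times G)/L]$ with $L\in\mathcal{S}_{G,G}$. For $n\ge 0$ let $B^{\mathcal{S}}_n(G,G)$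 be the group of those $a\in B^{\mathcal{S}}(G,G)$ such that $\Phi_{\{(\alpha(v),v)\mid v\in V\}}(a)=0$ for all subgroups $U,V\le G$ and all epimorphisms $\alpha\colon V\to U$ for which the composition length of $\ker(\alpha)$ is different from $n$; here $\Phi_L([X])=|X^L|$. For a commutative ring $R$ write $RB^{\mathcal{S}}(G,G)=R\otimes_{\mathbb{Z}}B^{\mathcal{S}}(G,G)$ and $RB^{\mathcal{S}}_n(G,G)=R\otimes_{\mathbb{Z}}B^{\mathcal{S}}_n(G,G)$, viewed inside $R\otimes_{\mathbb{Z}}B(G,G)$, and similarly for $\Delta(\mathcal{S})$ in place of $\mathcal{S}$. For $U\le G$ let $\mathrm{Out}_{\Delta(\mathcal{S})_G}(U)$ be the group of automorphisms $\varphi$ of $U$ with $\{(\varphi(u),u)\mid u\in U\}\in\mathcal{S}_{G,G}$, modulo the inner automorphisms of $U$. Let $G\in\mathcal{D}$ and let $R$ be a field in which $|G|$ and $|\mathrm{Out}_{\Delta(\mathcal{S})_G}(U)|$, for every subgroup $U\le G$, are invertible. Then the subspaces $RB^{\mathcal{S}}_n(G,G)$, $n\ge 0$, are linearly independent, $\bigoplus_{n\ge1}RB^{\mathcal{S}}_n(G,G)$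 is an ideal of $RB^{\mathcal{S}}(G,G)$, it is the kernel of an $R$-algebra homomorphism $\pi\colon RB^{\mathcal{S}}(G,G)\to RB^{\Delta(\mathcal{S})}(G,G)$ that is the identity on the subalgebra $RB^{\Delta(\mathcal{S})}(G,G)$, and restriction of modules from $RB^{\mathcal{S}}(G,G)$ to $RB^{\Delta(\mathcal{S})}(G,G)$ sends simple modules to simple modules and induces a bijection from the set of isomorphism classes of simple $RB^{\mathcal{S}}(G,G)$-modules to the set of isomorphism classes of simple $RB^{\Delta(\mathcal{S})}(G,G)$-modules. The inverse bijection is given by inflation with respect to the ideal $\bigoplus_{n\ge1}RB^{\mathcal{S}}_n(G,G)$, i.e. by restriction of modules along $\pi$. -/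

import Mathlib

open scoped TensorProduct

universe u v w x

namespace DoubleBurnside

section Bisets

/-- A `(G, H)`-biset: a finite left `G × H`-set. The left `G`- and right `H`-action are
recovered by `g x h = (g, h⁻¹) • x`. -/
structure Biset (G H : Type u) [Group G] [Group H] where
  carrier : Type u
  [finite : Finite carrier]
  [action : MulAction (G × H) carrier]

attribute [instance] Biset.finite Biset.action

variable {G H K L : Type u} [Group G] [Group H] [Group K] [Group L]

/-- Isomorphism of bisets. -/
def Biset.Iso (X Y : Biset G H) : Prop :=
  ∃ e : X.carrier ≃ Y.carrier, ∀ (a : G × H) (x : X.carrier), e (a • x) = a • e x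

theorem Biset.Iso.refl (X : Biset G H) : X.Iso X := ⟨Equiv.refl _, fun _ _ => rfl⟩

theorem Biset.Iso.symm {X Y : Biset G H} : X.Iso Y → Y.Iso X := by
  rintro ⟨e, he⟩
  exact ⟨e.symm, fun a y => by rw [Equiv.symm_apply_eq, he, Equiv.apply_symm_apply]⟩

theorem Biset.Iso.trans {X Y Z : Biset G H} : X.Iso Y → Y.Iso Z → X.Iso Z := by
  rintro ⟨e, he⟩ ⟨f, hf⟩
  exact ⟨e.trans f, fun a x => by simp [he, hf]⟩

instance Biset.setoid (G H : Type u) [Group G] [Group H] : Setoid (Biset G H) :=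
  ⟨Biset.Iso, Biset.Iso.refl, Biset.Iso.symm, Biset.Iso.trans⟩

/-- Disjoint union of bisets. -/
def Biset.coprod (X Y : Biset G H) : Biset G H where
  carrier := X.carrier ⊕ Y.carrier

/-- The empty biset. -/
def Biset.empty (G H : Type u) [Group G] [Group H] : Biset G H where
  carrier := PEmpty.{u + 1}
  action :=
    { smul := fun _ x => x
      one_smul := fun _ => rfl
      mul_smul := fun _ _ _ => rfl }

/-- The transitive biset `(G × H) / M`. -/
def Biset.transitive [Finite G] [Finite H] (M : Subgroup (G × H)) : Biset G H where
  carrier := (G × H) ⧸ M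

/-- The group `G` as a `(G, G)`-biset, by left and right multiplication. -/
def Biset.regular (G : Type u) [Group G] [Finite G] : Biset G G where
  carrier := G
  action :=
    { smul := fun a x => a.1 * x * a.2⁻¹
      one_smul := fun x => by
        change (1 : G) * x * (1 : G)⁻¹ = x
        simp
      mul_smul := fun a b x => by
        change (a.1 * b.1) * x * (a.2 * b.2)⁻¹ = a.1 * (b.1 * x * b.2⁻¹) * a.2⁻¹
        simp [mul_assoc] }

/-- The equivalence relation on `X × Y` whose classes are the orbits of the left `H`-action
`h (x, y) = (x h⁻¹, h y)`. -/
def Biset.tensorSetoid (X : Biset G H) (Y : Biset H K) : Setoid (X.carrier × Y.carrier) where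
  r p q := ∃ h : H, (((1, h) : G × H) • p.1, ((h, 1) : H × K) • p.2) = q
  iseqv :=
    { refl := fun p => ⟨1, by
        rw [← Prod.one_eq_mk, ← Prod.one_eq_mk, one_smul, one_smul]⟩
      symm := by
        rintro p _ ⟨h, rfl⟩
        refine ⟨h⁻¹, ?_⟩
        simp only [smul_smul, Prod.mk_mul_mk, mul_one, inv_mul_cancel]
        rw [← Prod.one_eq_mk, ← Prod.one_eq_mk, one_smul, one_smul]
      trans := by
        rintro p _ _ ⟨h, rfl⟩ ⟨h', rfl⟩
        exact ⟨h' * h, by simp only [smul_smul, Prod.mk_mul_mk, mul_one]⟩ }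

/-- The tensor product `X ×_H Y` of bisets, with `g (x ×_H y) k = g x ×_H y k`. -/
def Biset.tensor (X : Biset G H) (Y : Biset H K) : Biset G K where
  carrier := Quotient (Biset.tensorSetoid X Y)
  action :=
    { smul := fun a => Quotient.map
        (fun p => (((a.1, 1) : G × H) • p.1, ((1, a.2) : H × K) • p.2)) (by
          rintro p _ ⟨h, rfl⟩
          exact ⟨h, by simp only [smul_smul, Prod.mk_mul_mk, mul_one, one_mul]⟩)
      one_smul := by
        rintro ⟨p⟩
        change Quotient.mk _ _ = Quotient.mk _ _
        congr 1
        change (((1, 1) : G × H) • p.1, ((1, 1) : H × K) • p.2) = p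
        rw [← Prod.one_eq_mk, ← Prod.one_eq_mk, one_smul, one_smul]
      mul_smul := by
        rintro a b ⟨p⟩
        change Quotient.mk _ _ = Quotient.mk _ _
        congr 1
        simp only [smul_smul, Prod.mk_mul_mk, mul_one, Prod.fst_mul, Prod.snd_mul] }

/-- The element `x ×_H y`. -/
def Biset.tmul (X : Biset G H) (Y : Biset H K) (x : X.carrier) (y : Y.carrier) :
    (X.tensor Y).carrier :=
  Quotient.mk (Biset.tensorSetoid X Y) (x, y)

theorem Biset.tmul_surj {X : Biset G H} {Y : Biset H K} (z : (X.tensor Y).carrier) :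
    ∃ x y, X.tmul Y x y = z := by
  obtain ⟨⟨x, y⟩⟩ := z
  exact ⟨x, y, rfl⟩

theorem Biset.smul_tmul {X : Biset G H} {Y : Biset H K} (a : G × K) (x : X.carrier)
    (y : Y.carrier) :
    a • X.tmul Y x y = X.tmul Y (((a.1, 1) : G × H) • x) (((1, a.2) : H × K) • y) := rfl

theorem Biset.tmul_eq_iff {X : Biset G H} {Y : Biset H K} {x x' : X.carrier} {y y' : Y.carrier} :
    X.tmul Y x y = X.tmul Y x' y' ↔
      ∃ h : H, ((1, h) : G × H) • x = x' ∧ ((h, 1) : H × K) • y = y' := by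
  refine Quotient.eq.trans ?_
  change (∃ h : H, (((1, h) : G × H) • x, ((h, 1) : H × K) • y) = (x', y')) ↔ _
  simp only [Prod.mk.injEq]

/-- A map out of a tensor product, from a balanced map. -/
def Biset.tensorLift {X : Biset G H} {Y : Biset H K} {T : Type u}
    (f : X.carrier → Y.carrier → T)
    (hf : ∀ (h : H) x y, f (((1, h) : G × H) • x) (((h, 1) : H × K) • y) = f x y) :
    (X.tensor Y).carrier → T :=
  Quotient.lift (fun p : X.carrier × Y.carrier => f p.1 p.2) (by
    rintro p _ ⟨h, rfl⟩
    exact (hf h p.1 p.2).symm)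

/-- A bijective balanced equivariant map gives an isomorphism from the tensor product. -/
theorem Biset.tensor_iso {X : Biset G H} {Y : Biset H K} {Z : Biset G K}
    (f : X.carrier → Y.carrier → Z.carrier)
    (hf : ∀ x y x' y', f x y = f x' y' ↔
      ∃ h : H, ((1, h) : G × H) • x = x' ∧ ((h, 1) : H × K) • y = y')
    (hs : ∀ z, ∃ x y, f x y = z)
    (he : ∀ (a : G × K) x y, f (((a.1, 1) : G × H) • x) (((1, a.2) : H × K) • y) = a • f x y) :
    (X.tensor Y).Iso Z := by
  have hb : ∀ (h : H) x y, f (((1, h) : G × H) • x) (((h, 1) : H × K) • y) = f x y :=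
    fun h x y => ((hf _ _ _ _).2 ⟨h, rfl, rfl⟩).symm
  refine ⟨Equiv.ofBijective (Biset.tensorLift f hb) ⟨?_, ?_⟩, ?_⟩
  · intro p q hpq
    obtain ⟨x, y, rfl⟩ := Biset.tmul_surj p
    obtain ⟨x', y', rfl⟩ := Biset.tmul_surj q
    exact Biset.tmul_eq_iff.2 ((hf _ _ _ _).1 hpq)
  · intro z
    obtain ⟨x, y, rfl⟩ := hs z
    exact ⟨X.tmul Y x y, rfl⟩
  · intro a p
    obtain ⟨x, y, rfl⟩ := Biset.tmul_surj p
    exact he a x y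

theorem Biset.tensor_congr {X X' : Biset G H} {Y Y' : Biset H K} (hX : X.Iso X')
    (hY : Y.Iso Y') : (X.tensor Y).Iso (X'.tensor Y') := by
  obtain ⟨e, he⟩ := hX
  obtain ⟨f, hf⟩ := hY
  refine Biset.tensor_iso (fun x y => X'.tmul Y' (e x) (f y)) ?_ ?_ ?_
  · intro x y x' y'
    rw [Biset.tmul_eq_iff]
    simp only [← he, ← hf, EmbeddingLike.apply_eq_iff_eq]
  · intro z
    obtain ⟨x, y, rfl⟩ := Biset.tmul_surj z
    exact ⟨e.symm x, f.symm y, by simp⟩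
  · intro a x y
    simp only [Biset.smul_tmul, he, hf]

theorem Biset.tensor_assoc (X : Biset G H) (Y : Biset H K) (Z : Biset K L) :
    ((X.tensor Y).tensor Z).Iso (X.tensor (Y.tensor Z)) := by
  have key : ∀ (z : Z.carrier) (h : H) (x : X.carrier) (y : Y.carrier),
      X.tmul (Y.tensor Z) (((1, h) : G × H) • x) (Y.tmul Z (((h, 1) : H × K) • y) z) =
        X.tmul (Y.tensor Z) x (Y.tmul Z y z) := by
    intro z h x y
    symm
    rw [Biset.tmul_eq_iff]
    refine ⟨h, rfl, ?_⟩
    rw [Biset.smul_tmul, ← Prod.one_eq_mk, one_smul]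
  refine Biset.tensor_iso (fun p z => Biset.tensorLift (X := X) (Y := Y)
    (fun x y => X.tmul (Y.tensor Z) x (Y.tmul Z y z)) (key z) p) ?_ ?_ ?_
  · intro p z p' z'
    obtain ⟨x, y, rfl⟩ := Biset.tmul_surj p
    obtain ⟨x', y', rfl⟩ := Biset.tmul_surj p'
    change X.tmul (Y.tensor Z) x (Y.tmul Z y z) = X.tmul (Y.tensor Z) x' (Y.tmul Z y' z') ↔ _
    rw [Biset.tmul_eq_iff]
    simp only [Biset.smul_tmul, Biset.tmul_eq_iff, smul_smul, Prod.mk_mul_mk, mul_one, one_mul,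
      Prod.mk_one_one]
    constructor
    · rintro ⟨h, hx, k, hy, hz⟩
      refine ⟨k, ⟨h, ?_, ?_⟩, hz⟩
      · rw [← hx]
      · exact hy
    · rintro ⟨k, ⟨h, hx, hy⟩, hz⟩
      refine ⟨h, ?_, k, hy, hz⟩
      simpa only [one_smul] using hx
  · intro w
    obtain ⟨x, q, rfl⟩ := Biset.tmul_surj w
    obtain ⟨y, z, rfl⟩ := Biset.tmul_surj q
    exact ⟨X.tmul Y x y, z, rfl⟩
  · intro a p z
    obtain ⟨x, y, rfl⟩ := Biset.tmul_surj p
    change X.tmul (Y.tensor Z) (((a.1, 1) : G × H) • x)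
      (Y.tmul Z (((1, 1) : H × K) • y) (((1, a.2) : K × L) • z)) =
        a • X.tmul (Y.tensor Z) x (Y.tmul Z y z)
    rw [Biset.smul_tmul, Biset.smul_tmul]

theorem Biset.regular_tensor [Finite G] (X : Biset G H) : ((Biset.regular G).tensor X).Iso X := by
  refine Biset.tensor_iso (fun (g : G) x => ((g, 1) : G × H) • x) ?_ ?_ ?_
  · intro (g : G) x (g' : G) x'
    change _ ↔ ∃ h : G, (1 * g * h⁻¹ : G) = g' ∧ _
    constructor
    · intro h
      refine ⟨g'⁻¹ * g, by group, ?_⟩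
      have h2 := congrArg (fun z => ((g'⁻¹, 1) : G × H) • z) h
      simp only [smul_smul, Prod.mk_mul_mk, mul_one, inv_mul_cancel] at h2
      rw [h2, ← Prod.one_eq_mk, one_smul]
    · rintro ⟨h, rfl, rfl⟩
      simp [smul_smul]
  · intro x
    exact ⟨(1 : G), x, by rw [← Prod.one_eq_mk, one_smul]⟩
  · intro a (g : G) x
    change ((a.1 * g * (1 : G)⁻¹, 1) : G × H) • ((1, a.2) : G × H) • x = a • ((g, 1) : G × H) • x
    simp only [smul_smul, Prod.mk_mul_mk]
    congr 1
    ext <;> simp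

theorem Biset.tensor_regular [Finite H] (X : Biset G H) : (X.tensor (Biset.regular H)).Iso X := by
  refine Biset.tensor_iso (fun x (h : H) => ((1, h⁻¹) : G × H) • x) ?_ ?_ ?_
  · intro x (k : H) x' (k' : H)
    change _ ↔ ∃ h : H, _ ∧ (h * k * (1 : H)⁻¹ : H) = k'
    constructor
    · intro h
      refine ⟨k' * k⁻¹, ?_, by group⟩
      have h2 := congrArg (fun z => ((1, k') : G × H) • z) h
      simp only [smul_smul, Prod.mk_mul_mk, mul_one, mul_inv_cancel] at h2
      rw [h2, ← Prod.one_eq_mk, one_smul]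
    · rintro ⟨h, rfl, rfl⟩
      simp [smul_smul]
  · intro x
    exact ⟨x, (1 : H), by rw [inv_one, ← Prod.one_eq_mk, one_smul]⟩
  · intro a x (k : H)
    change ((1, (1 * k * a.2⁻¹)⁻¹) : G × H) • ((a.1, 1) : G × H) • x = a • ((1, k⁻¹) : G × H) • x
    simp only [smul_smul, Prod.mk_mul_mk]
    congr 1
    ext <;> simp

theorem Biset.coprod_congr {X X' Y Y' : Biset G H} (hX : X.Iso X') (hY : Y.Iso Y') :
    (X.coprod Y).Iso (X'.coprod Y') := by
  obtain ⟨e, he⟩ := hX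
  obtain ⟨f, hf⟩ := hY
  refine ⟨Equiv.sumCongr e f, ?_⟩
  rintro a (x | y)
  · exact congrArg Sum.inl (he a x)
  · exact congrArg Sum.inr (hf a y)

theorem Biset.tensor_coprod (X : Biset G H) (Y Z : Biset H K) :
    (X.tensor (Y.coprod Z)).Iso ((X.tensor Y).coprod (X.tensor Z)) := by
  refine Biset.tensor_iso (fun x (w : Y.carrier ⊕ Z.carrier) =>
    (Sum.map (X.tmul Y x) (X.tmul Z x) w : (X.tensor Y).carrier ⊕ (X.tensor Z).carrier)) ?_ ?_ ?_
  · rintro x (y | z) x' (y' | z')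
    · exact Sum.inl_injective.eq_iff.trans (Biset.tmul_eq_iff.trans
        (exists_congr fun h => and_congr_right fun _ => Sum.inl_injective.eq_iff.symm))
    · exact ⟨fun h => (Sum.inl_ne_inr h).elim, fun ⟨_, _, h⟩ => (Sum.inl_ne_inr h).elim⟩
    · exact ⟨fun h => (Sum.inr_ne_inl h).elim, fun ⟨_, _, h⟩ => (Sum.inr_ne_inl h).elim⟩
    · exact Sum.inr_injective.eq_iff.trans (Biset.tmul_eq_iff.trans
        (exists_congr fun h => and_congr_right fun _ => Sum.inr_injective.eq_iff.symm))
  · rintro (w | w)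
    · obtain ⟨x, y, rfl⟩ := Biset.tmul_surj w
      exact ⟨x, Sum.inl y, rfl⟩
    · obtain ⟨x, y, rfl⟩ := Biset.tmul_surj w
      exact ⟨x, Sum.inr y, rfl⟩
  · rintro a x (y | z) <;> rfl

theorem Biset.coprod_tensor (X Y : Biset G H) (Z : Biset H K) :
    ((X.coprod Y).tensor Z).Iso ((X.tensor Z).coprod (Y.tensor Z)) := by
  refine Biset.tensor_iso (fun (w : X.carrier ⊕ Y.carrier) z =>
    (Sum.map (fun x => X.tmul Z x z) (fun y => Y.tmul Z y z) w :
      (X.tensor Z).carrier ⊕ (Y.tensor Z).carrier)) ?_ ?_ ?_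
  · rintro (x | y) z (x' | y') z'
    · exact Sum.inl_injective.eq_iff.trans (Biset.tmul_eq_iff.trans
        (exists_congr fun h => and_congr_left fun _ => Sum.inl_injective.eq_iff.symm))
    · exact ⟨fun h => (Sum.inl_ne_inr h).elim, fun ⟨_, h, _⟩ => (Sum.inl_ne_inr h).elim⟩
    · exact ⟨fun h => (Sum.inr_ne_inl h).elim, fun ⟨_, h, _⟩ => (Sum.inr_ne_inl h).elim⟩
    · exact Sum.inr_injective.eq_iff.trans (Biset.tmul_eq_iff.trans
        (exists_congr fun h => and_congr_left fun _ => Sum.inr_injective.eq_iff.symm))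
  · rintro (w | w)
    · obtain ⟨x, z, rfl⟩ := Biset.tmul_surj w
      exact ⟨Sum.inl x, z, rfl⟩
    · obtain ⟨y, z, rfl⟩ := Biset.tmul_surj w
      exact ⟨Sum.inr y, z, rfl⟩
  · rintro a (x | y) z <;> rfl

theorem Biset.tensor_empty (X : Biset G H) :
    (X.tensor (Biset.empty H K)).Iso (Biset.empty G K) :=
  Biset.tensor_iso (fun _ (y : PEmpty) => y.elim) (fun _ (y : PEmpty) => y.elim)
    (fun (z : PEmpty) => z.elim) (fun _ _ (y : PEmpty) => y.elim)

theorem Biset.empty_tensor (Y : Biset H K) :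
    ((Biset.empty G H).tensor Y).Iso (Biset.empty G K) :=
  Biset.tensor_iso (fun (x : PEmpty) _ => x.elim) (fun (x : PEmpty) => x.elim)
    (fun (z : PEmpty) => z.elim) (fun _ (x : PEmpty) => x.elim)

/-- Isomorphism classes of bisets. -/
def BisetClass (G H : Type u) [Group G] [Group H] : Type (u + 1) :=
  Quotient (Biset.setoid G H)

/-- The isomorphism class of a biset. -/
def BisetClass.mk (X : Biset G H) : BisetClass G H := Quotient.mk _ X

theorem BisetClass.mk_eq_iff {X Y : Biset G H} : BisetClass.mk X = BisetClass.mk Y ↔ X.Iso Y :=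
  Quotient.eq

theorem BisetClass.ind {p : BisetClass G H → Prop} (h : ∀ X, p (BisetClass.mk X)) (a) : p a :=
  Quotient.ind h a

instance : Add (BisetClass G H) :=
  ⟨Quotient.map₂ Biset.coprod fun _ _ hX _ _ hY => Biset.coprod_congr hX hY⟩

instance : Zero (BisetClass G H) := ⟨BisetClass.mk (Biset.empty G H)⟩

/-- Isomorphism classes of bisets form a commutative monoid under disjoint union. -/
instance : AddCommMonoid (BisetClass G H) where
  add_assoc := by
    rintro ⟨X⟩ ⟨Y⟩ ⟨Z⟩
    exact BisetClass.mk_eq_iff.2 ⟨Equiv.sumAssoc _ _ _, by rintro a ((x | y) | z) <;> rfl⟩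
  add_comm := by
    rintro ⟨X⟩ ⟨Y⟩
    exact BisetClass.mk_eq_iff.2 ⟨Equiv.sumComm _ _, by rintro a (x | y) <;> rfl⟩
  zero_add := by
    rintro ⟨X⟩
    exact BisetClass.mk_eq_iff.2 ⟨Equiv.emptySum PEmpty X.carrier, by
      rintro a (x | y)
      · exact x.elim
      · rfl⟩
  add_zero := by
    rintro ⟨X⟩
    exact BisetClass.mk_eq_iff.2 ⟨Equiv.sumEmpty X.carrier PEmpty, by
      rintro a (y | x)
      · rfl
      · exact x.elim⟩
  nsmul := nsmulRec

theorem BisetClass.mk_add (X Y : Biset G H) :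
    BisetClass.mk X + BisetClass.mk Y = BisetClass.mk (X.coprod Y) := rfl

/-- The tensor product on isomorphism classes, as a biadditive map. -/
def BisetClass.tensor : BisetClass G H →+ BisetClass H K →+ BisetClass G K where
  toFun a :=
    { toFun := fun b =>
        Quotient.map₂ Biset.tensor (fun _ _ hX _ _ hY => Biset.tensor_congr hX hY) a b
      map_zero' := by
        obtain ⟨X⟩ := a
        exact BisetClass.mk_eq_iff.2 (Biset.tensor_empty X)
      map_add' := by
        obtain ⟨X⟩ := a
        rintro ⟨Y⟩ ⟨Z⟩
        exact BisetClass.mk_eq_iff.2 (Biset.tensor_coprod X Y Z) }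
  map_zero' := by
    ext ⟨Y⟩
    exact BisetClass.mk_eq_iff.2 (Biset.empty_tensor Y)
  map_add' := by
    rintro ⟨X⟩ ⟨Y⟩
    ext ⟨Z⟩
    exact BisetClass.mk_eq_iff.2 (Biset.coprod_tensor X Y Z)

theorem BisetClass.tensor_mk (X : Biset G H) (Y : Biset H K) :
    BisetClass.tensor (BisetClass.mk X) (BisetClass.mk Y) = BisetClass.mk (X.tensor Y) := rfl

/-- The number of fixed points under a subgroup, as an additive map on isomorphism classes. -/
noncomputable def BisetClass.mark (M : Subgroup (G × H)) : BisetClass G H →+ ℤ where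
  toFun := Quotient.lift (fun X : Biset G H => (Nat.card (MulAction.fixedPoints M X.carrier) : ℤ)) (by
    rintro X Y ⟨e, he⟩
    refine congrArg Nat.cast (Nat.card_congr (e.subtypeEquiv fun x => ?_))
    refine forall_congr' fun m => ?_
    change (m : G × H) • x = x ↔ (m : G × H) • e x = e x
    rw [← he, EmbeddingLike.apply_eq_iff_eq])
  map_zero' := by
    have : IsEmpty (Biset.empty G H).carrier := inferInstanceAs (IsEmpty PEmpty)
    change ((Nat.card (MulAction.fixedPoints M (Biset.empty G H).carrier) : ℕ) : ℤ) = 0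
    simp
  map_add' := by
    rintro ⟨X⟩ ⟨Y⟩
    change ((Nat.card (MulAction.fixedPoints M (X.carrier ⊕ Y.carrier)) : ℕ) : ℤ) =
      (Nat.card (MulAction.fixedPoints M X.carrier) : ℤ) +
        (Nat.card (MulAction.fixedPoints M Y.carrier) : ℤ)
    rw [← Nat.cast_add, ← Nat.card_sum]
    refine congrArg Nat.cast (Nat.card_congr ((Equiv.subtypeSum
      (p := fun z => z ∈ MulAction.fixedPoints M (X.carrier ⊕ Y.carrier))).trans
        (Equiv.sumCongr (Equiv.subtypeEquivRight fun x => ?_)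
          (Equiv.subtypeEquivRight fun y => ?_))))
    · exact forall_congr' fun m => Sum.inl_injective.eq_iff
    · exact forall_congr' fun m => Sum.inr_injective.eq_iff

end Bisets

section Burnside

variable {G H K L : Type u} [Group G] [Group H] [Group K] [Group L]

/-- The double Burnside group `B(G, H)`: the Grothendieck group of `(G, H)`-bisets with respect to
disjoint unions. -/
def B (G H : Type u) [Group G] [Group H] : Type (u + 1) :=
  Algebra.GrothendieckAddGroup (BisetClass G H)

instance : AddCommGroup (B G H) :=
  inferInstanceAs (AddCommGroup (Algebra.GrothendieckAddGroup (BisetClass G H)))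

/-- The class map from isomorphism classes to the double Burnside group. -/
def B.of : BisetClass G H →+ B G H := Algebra.GrothendieckAddGroup.of

/-- The universal property of the Grothendieck group. -/
noncomputable def B.lift {A : Type v} [AddCommGroup A] (f : BisetClass G H →+ A) : B G H →+ A :=
  Algebra.GrothendieckAddGroup.lift f

theorem B.lift_of {A : Type v} [AddCommGroup A] (f : BisetClass G H →+ A) (a : BisetClass G H) :
    B.lift f (B.of a) = f a :=
  DFunLike.congr_fun (Algebra.GrothendieckAddGroup.lift.symm_apply_apply f) a

theorem B.hom_ext {A : Type v} [AddCommGroup A] {f g : B G H →+ A}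
    (h : ∀ a, f (B.of a) = g (B.of a)) : f = g :=
  (Algebra.GrothendieckAddGroup.lift (M := BisetClass G H) (G := A)).symm.injective
    (DFunLike.ext _ _ h)

@[elab_as_elim]
theorem B.ind {p : B G H → Prop} (of : ∀ a, p (B.of a)) (sub : ∀ a b, p a → p b → p (a - b))
    (a : B G H) : p a := by
  induction a using AddLocalization.induction_on with
  | H y =>
    have h : (AddLocalization.mk y.1 y.2 : Algebra.GrothendieckAddGroup (BisetClass G H)) =
        AddLocalization.mk y.1 0 - AddLocalization.mk (y.2 : BisetClass G H) 0 := by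
      refine Eq.trans ?_ (Algebra.GrothendieckAddGroup.mk_sub_mk y.1 y.2 0 0).symm
      congr 1
      · exact (add_zero _).symm
      · exact Subtype.ext (zero_add _).symm
    change p (AddLocalization.mk y.1 y.2 : Algebra.GrothendieckAddGroup (BisetClass G H))
    rw [h]
    exact sub _ _ (of _) (of _)

/-- The class `[X]` of a biset. -/
def B.cls (X : Biset G H) : B G H := B.of (BisetClass.mk X)

/-- The biadditive map `B(G, H) × B(H, K) → B(G, K)` with `[X] ⬝ [Y] = [X ×_H Y]`. -/
noncomputable def B.tensor : B G H →+ B H K →+ B G K :=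
  B.lift
    { toFun := fun a => B.lift (B.of.comp (BisetClass.tensor a))
      map_zero' := B.hom_ext fun b => by simp [B.lift_of]
      map_add' := fun a a' => B.hom_ext fun b => by simp [B.lift_of] }

theorem B.tensor_of (a : BisetClass G H) (b : BisetClass H K) :
    B.tensor (B.of a) (B.of b) = B.of (BisetClass.tensor a b) := by
  simp [B.tensor, B.lift_of]

theorem B.tensor_cls (X : Biset G H) (Y : Biset H K) :
    B.tensor (B.cls X) (B.cls Y) = B.cls (X.tensor Y) := B.tensor_of _ _

theorem B.tensor_assoc (a : B G H) (b : B H K) (c : B K L) :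
    B.tensor (B.tensor a b) c = B.tensor a (B.tensor b c) := by
  induction a using B.ind with
  | sub a a' ha ha' => simp only [map_sub, AddMonoidHom.sub_apply, ha, ha']
  | of x =>
    induction b using B.ind with
    | sub b b' hb hb' => simp only [map_sub, AddMonoidHom.sub_apply, hb, hb']
    | of y =>
      induction c using B.ind with
      | sub c c' hc hc' => simp only [map_sub, hc, hc']
      | of z =>
        rw [B.tensor_of, B.tensor_of, B.tensor_of, B.tensor_of]
        obtain ⟨X⟩ := x
        obtain ⟨Y⟩ := y
        obtain ⟨Z⟩ := z
        exact congrArg B.of (BisetClass.mk_eq_iff.2 (Biset.tensor_assoc X Y Z))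

theorem B.regular_tensor [Finite G] (a : B G H) : B.tensor (B.cls (Biset.regular G)) a = a := by
  induction a using B.ind with
  | sub a b ha hb => rw [map_sub, ha, hb]
  | of x =>
    obtain ⟨X⟩ := x
    exact (B.tensor_of _ _).trans
      (congrArg B.of (BisetClass.mk_eq_iff.2 (Biset.regular_tensor X)))

theorem B.tensor_regular [Finite H] (a : B G H) : B.tensor a (B.cls (Biset.regular H)) = a := by
  induction a using B.ind with
  | sub a b ha hb => rw [map_sub, AddMonoidHom.sub_apply, ha, hb]
  | of x =>
    obtain ⟨X⟩ := x
    exact (B.tensor_of _ _).trans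
      (congrArg B.of (BisetClass.mk_eq_iff.2 (Biset.tensor_regular X)))

/-- The double Burnside ring `B(G, G)`. -/
noncomputable instance [Finite G] : Ring (B G G) :=
  { (inferInstance : AddCommGroup (B G G)) with
    mul := fun a b => B.tensor a b
    one := B.cls (Biset.regular G)
    mul_assoc := B.tensor_assoc
    one_mul := B.regular_tensor
    mul_one := B.tensor_regular
    zero_mul := fun a => by
      change B.tensor 0 a = 0
      simp
    mul_zero := fun a => by
      change B.tensor a 0 = 0
      simp
    left_distrib := fun a b c => by
      change B.tensor a (b + c) = B.tensor a b + B.tensor a c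
      simp
    right_distrib := fun a b c => by
      change B.tensor (a + b) c = B.tensor a c + B.tensor b c
      simp }

theorem B.mul_def [Finite G] (a b : B G G) : a * b = B.tensor a b := rfl

theorem B.one_def [Finite G] : (1 : B G G) = B.cls (Biset.regular G) := rfl

/-- The mark `Φ_M : B(G, H) → ℤ`, `[X] ↦ |X^M|`. -/
noncomputable def B.mark (M : Subgroup (G × H)) : B G H →+ ℤ := B.lift (BisetClass.mark M)

end Burnside

section Subgroups

variable {G H K : Type u} [Group G] [Group H] [Group K]

/-- `k₁(M) = {g | (g, 1) ∈ M}`. -/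
def k₁ (M : Subgroup (G × H)) : Subgroup G := M.comap (MonoidHom.inl G H)

/-- `k₂(M) = {h | (1, h) ∈ M}`. -/
def k₂ (M : Subgroup (G × H)) : Subgroup H := M.comap (MonoidHom.inr G H)

/-- The subgroups `M ≤ G × H` with `k₁(M) = 1`; they are the graphs `{(α h, h) | h ∈ V}` of
epimorphisms `α : V → U` between subgroups `V ≤ H` and `U ≤ G`. -/
def leftFreeSubgroups (G H : Type u) [Group G] [Group H] : Set (Subgroup (G × H)) :=
  {M | k₁ M = ⊥}

/-- The twisted diagonal subgroups of `G × H`, i.e. those with `k₁(M) = 1` and `k₂(M) = 1`; they are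
the graphs `{(α h, h) | h ∈ V}` of isomorphisms `α : V → U` between subgroups `V ≤ H` and
`U ≤ G`. -/
def twistedDiagonalSubgroups (G H : Type u) [Group G] [Group H] : Set (Subgroup (G × H)) :=
  {M | k₁ M = ⊥ ∧ k₂ M = ⊥}

/-- The subgroup `{(α h, h) | h ∈ V}` of `G × H` attached to `α : V → U`. -/
def graph {U : Subgroup G} {V : Subgroup H} (α : V →* U) : Subgroup (G × H) :=
  ((U.subtype.comp α).prod V.subtype).range

theorem mem_graph {U : Subgroup G} {V : Subgroup H} (α : V →* U) (p : G × H) :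
    p ∈ graph α ↔ ∃ v : V, ((α v : G), (v : H)) = p := Iff.rfl

/-- The diagonal subgroup of `G × G`. -/
def diagonal (G : Type u) [Group G] : Subgroup (G × G) :=
  ((MonoidHom.id G).prod (MonoidHom.id G)).range

/-- The composition `M * N` of subgroups `M ≤ G × H` and `N ≤ H × K`, viewed as relations. -/
def star (M : Subgroup (G × H)) (N : Subgroup (H × K)) : Subgroup (G × K) where
  carrier := {p | ∃ h : H, (p.1, h) ∈ M ∧ (h, p.2) ∈ N}
  one_mem' := ⟨1, M.one_mem, N.one_mem⟩
  mul_mem' := by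
    rintro p q ⟨h, h1, h2⟩ ⟨h', h1', h2'⟩
    exact ⟨h * h', M.mul_mem h1 h1', N.mul_mem h2 h2'⟩
  inv_mem' := by
    rintro p ⟨h, h1, h2⟩
    exact ⟨h⁻¹, M.inv_mem h1, N.inv_mem h2⟩

theorem mem_star {M : Subgroup (G × H)} {N : Subgroup (H × K)} {p : G × K} :
    p ∈ star M N ↔ ∃ h : H, (p.1, h) ∈ M ∧ (h, p.2) ∈ N := Iff.rfl

/-- A composition series of length `n`: a chain `1 = s 0 ≤ s 1 ≤ ⋯ ≤ s n = K`, each term normal in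
the next one with simple quotient. -/
def HasCompositionSeries (K : Type u) [Group K] (n : ℕ) : Prop :=
  ∃ s : Fin (n + 1) → Subgroup K, s 0 = ⊥ ∧ s (Fin.last n) = ⊤ ∧
    ∀ i : Fin n, s i.castSucc ≤ s i.succ ∧
      ∃ _ : ((s i.castSucc).subgroupOf (s i.succ)).Normal,
        IsSimpleGroup (s i.succ ⧸ (s i.castSucc).subgroupOf (s i.succ))

/-- The composition length `l(K)` of a finite group `K`: the length of a composition series (all
of them have the same length). -/
noncomputable def compositionLength (K : Type u) [Group K] : ℕ :=
  sInf {n | HasCompositionSeries K n}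

/-- `B^T(G, H)`: the subgroup of `B(G, H)` spanned by the classes `[(G × H) / M]`, `M ∈ T`. -/
def BSpan [Finite G] [Finite H] (T : Set (Subgroup (G × H))) : AddSubgroup (B G H) :=
  AddSubgroup.closure {x | ∃ M ∈ T, x = B.cls (Biset.transitive M)}

/-- `B^T_n(G, H)`: the elements of `B^T(G, H)` whose marks vanish at all graphs of epimorphisms
`α : V → U` with `l(ker α) ≠ n`. -/
def BGraded [Finite G] [Finite H] (T : Set (Subgroup (G × H))) (n : ℕ) : AddSubgroup (B G H) where
  carrier := {a | a ∈ BSpan T ∧ ∀ (U : Subgroup G) (V : Subgroup H) (α : V →* U),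
    Function.Surjective α → compositionLength α.ker ≠ n → B.mark (graph α) a = 0}
  zero_mem' := ⟨zero_mem _, fun _ _ _ _ _ => map_zero _⟩
  add_mem' := fun {a b} ha hb => ⟨add_mem ha.1 hb.1, fun U V α h1 h2 => by
    rw [map_add, ha.2 U V α h1 h2, hb.2 U V α h1 h2, add_zero]⟩
  neg_mem' := fun {a} ha => ⟨neg_mem ha.1, fun U V α h1 h2 => by
    rw [map_neg, ha.2 U V α h1 h2, neg_zero]⟩

theorem cls_mem_BSpan [Finite G] [Finite H] {T : Set (Subgroup (G × H))} (X : Biset G H)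
    (hX : ∀ x : X.carrier, MulAction.stabilizer (G × H) x ∈ T) : B.cls X ∈ BSpan T := by
  obtain ⟨n, hn⟩ : ∃ n, Nat.card X.carrier = n := ⟨_, rfl⟩
  induction n using Nat.strong_induction_on generalizing X with
  | _ n ih =>
    rcases isEmpty_or_nonempty X.carrier with he | ⟨⟨x⟩⟩
    · have h : B.cls X = 0 := by
        refine Eq.trans (congrArg B.of (BisetClass.mk_eq_iff.2
          ⟨⟨fun y => he.elim y, fun y => PEmpty.elim y, fun y => he.elim y,
            fun y => PEmpty.elim y⟩, fun _ y => he.elim y⟩ :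
              BisetClass.mk X = BisetClass.mk (Biset.empty G H))) (map_zero _)
      rw [h]
      exact zero_mem _
    · let C : SubMulAction (G × H) X.carrier :=
        { carrier := (MulAction.orbit (G × H) x)ᶜ
          smul_mem' := fun a y hy hay => hy ((MulAction.orbit_eq_iff.1 (MulAction.orbit_smul a y ▸
            MulAction.orbit_eq_iff.2 hay))) }
      let Y : Biset G H := { carrier := C }
      have hiso : ((Biset.transitive (MulAction.stabilizer (G × H) x)).coprod Y).Iso X := by
        let f : ((G × H) ⧸ MulAction.stabilizer (G × H) x) ⊕ C → X.carrier :=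
          Sum.elim (MulAction.ofQuotientStabilizer (G × H) x) Subtype.val
        have hf : Function.Bijective f := by
          constructor
          · rintro (p | p) (q | q) h
            · exact congrArg Sum.inl (MulAction.injective_ofQuotientStabilizer _ _ h)
            · exact (q.2 ((show MulAction.ofQuotientStabilizer (G × H) x p = q from h) ▸
                MulAction.ofQuotientStabilizer_mem_orbit _ _ p)).elim
            · exact (p.2 ((show (p : X.carrier) = MulAction.ofQuotientStabilizer (G × H) x q from h) ▸
                MulAction.ofQuotientStabilizer_mem_orbit _ _ q)).elim
            · exact congrArg Sum.inr (Subtype.ext h)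
          · intro y
            by_cases hy : y ∈ MulAction.orbit (G × H) x
            · obtain ⟨a, rfl⟩ := hy
              exact ⟨Sum.inl (QuotientGroup.mk a), MulAction.ofQuotientStabilizer_mk _ _ _⟩
            · exact ⟨Sum.inr ⟨y, hy⟩, rfl⟩
        refine ⟨Equiv.ofBijective f hf, ?_⟩
        rintro a (p | p)
        · exact MulAction.ofQuotientStabilizer_smul _ _ _ _
        · rfl
      have hcls : B.cls X =
          B.cls (Biset.transitive (MulAction.stabilizer (G × H) x)) + B.cls Y := by
        refine Eq.trans (congrArg B.of (BisetClass.mk_eq_iff.2 hiso).symm) ?_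
        rw [← BisetClass.mk_add, map_add]
        rfl
      rw [hcls]
      refine add_mem (AddSubgroup.subset_closure ⟨_, hX x, rfl⟩) (ih (Nat.card C) ?_ Y ?_ rfl)
      · rw [← hn]
        refine Finite.card_subtype_lt (x := x) ?_
        exact fun h => h (MulAction.mem_orbit_self x)
      · intro y
        have hy : MulAction.stabilizer (G × H) y =
            MulAction.stabilizer (G × H) (y : X.carrier) := by
          ext a
          exact Subtype.ext_iff
        exact hy ▸ hX y.1

theorem stabilizer_transitive [Finite G] [Finite H] (M : Subgroup (G × H))
    (x : (Biset.transitive M).carrier) :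
    ∃ a : G × H, MulAction.stabilizer (G × H) x = M.map (MulAut.conj a).toMonoidHom := by
  obtain ⟨a, rfl⟩ := QuotientGroup.mk_surjective (s := M) x
  refine ⟨a, ?_⟩
  have h := MulAction.stabilizer_smul_eq_stabilizer_map_conj a
    (QuotientGroup.mk 1 : (G × H) ⧸ M)
  rw [MulAction.stabilizer_quotient, MulAction.Quotient.smul_mk, smul_eq_mul, mul_one] at h
  exact h

theorem stabilizer_tmul (X : Biset G H) (Y : Biset H K) (x : X.carrier) (y : Y.carrier) :
    MulAction.stabilizer (G × K) (X.tmul Y x y) =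
      star (MulAction.stabilizer (G × H) x) (MulAction.stabilizer (H × K) y) := by
  ext a
  rw [MulAction.mem_stabilizer_iff, Biset.smul_tmul, Biset.tmul_eq_iff, mem_star]
  simp only [smul_smul, Prod.mk_mul_mk, mul_one, one_mul, MulAction.mem_stabilizer_iff]

end Subgroups

section Systems

/-- A system of sets of subgroups `S_{G,H}` of `G × H`, for `G` and `H` in a family of groups,
closed under conjugation, subgroups and composition, and containing the diagonals. -/
structure SubgroupSystem {ι : Type v} (𝓖 : ι → Type u) [∀ i, Group (𝓖 i)] where
  sets : ∀ i j, Set (Subgroup (𝓖 i × 𝓖 j))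
  conj_mem : ∀ {i j} {M : Subgroup (𝓖 i × 𝓖 j)}, M ∈ sets i j →
    ∀ a : 𝓖 i × 𝓖 j, M.map (MulAut.conj a).toMonoidHom ∈ sets i j
  mem_of_le : ∀ {i j} {M N : Subgroup (𝓖 i × 𝓖 j)}, M ∈ sets i j → N ≤ M → N ∈ sets i j
  star_mem : ∀ {i j k} {M : Subgroup (𝓖 i × 𝓖 j)} {N : Subgroup (𝓖 j × 𝓖 k)},
    M ∈ sets i j → N ∈ sets j k → star M N ∈ sets i k
  diagonal_mem : ∀ i, diagonal (𝓖 i) ∈ sets i i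

namespace SubgroupSystem

variable {ι : Type v} {𝓖 : ι → Type u} [∀ i, Group (𝓖 i)] (S : SubgroupSystem 𝓖)

/-- The subsystem `Δ(S)` of twisted diagonal subgroups in `S`. -/
def delta : SubgroupSystem 𝓖 where
  sets i j := S.sets i j ∩ twistedDiagonalSubgroups (𝓖 i) (𝓖 j)
  conj_mem := by
    rintro i j M ⟨hM, h1, h2⟩ a
    refine ⟨S.conj_mem hM a, (Subgroup.eq_bot_iff_forall _).2 ?_,
      (Subgroup.eq_bot_iff_forall _).2 ?_⟩
    · rintro g ⟨⟨m, n⟩, hm, hg⟩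
      have e1 : a.1 * m * a.1⁻¹ = g := congrArg Prod.fst hg
      have e2 : a.2 * n * a.2⁻¹ = 1 := congrArg Prod.snd hg
      rw [conj_eq_one_iff] at e2
      subst e2
      have : m = 1 := (Subgroup.eq_bot_iff_forall _).1 h1 m hm
      rw [← e1, this]
      simp
    · rintro g ⟨⟨m, n⟩, hm, hg⟩
      have e1 : a.1 * m * a.1⁻¹ = 1 := congrArg Prod.fst hg
      have e2 : a.2 * n * a.2⁻¹ = g := congrArg Prod.snd hg
      rw [conj_eq_one_iff] at e1
      subst e1
      have : n = 1 := (Subgroup.eq_bot_iff_forall _).1 h2 n hm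
      rw [← e2, this]
      simp
  mem_of_le := by
    rintro i j M N ⟨hM, h1, h2⟩ hN
    exact ⟨S.mem_of_le hM hN, le_bot_iff.1 (h1 ▸ Subgroup.comap_mono hN),
      le_bot_iff.1 (h2 ▸ Subgroup.comap_mono hN)⟩
  star_mem := by
    rintro i j k M N ⟨hM, h1, h2⟩ ⟨hN, h1', h2'⟩
    refine ⟨S.star_mem hM hN, (Subgroup.eq_bot_iff_forall _).2 ?_,
      (Subgroup.eq_bot_iff_forall _).2 ?_⟩
    · rintro g ⟨h, hg, hh⟩
      have : h = 1 := (Subgroup.eq_bot_iff_forall _).1 h1' h hh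
      subst this
      exact (Subgroup.eq_bot_iff_forall _).1 h1 g hg
    · rintro g ⟨h, hg, hh⟩
      have : h = 1 := (Subgroup.eq_bot_iff_forall _).1 h2 h hg
      subst this
      exact (Subgroup.eq_bot_iff_forall _).1 h2' g hh
  diagonal_mem := fun i => by
    refine ⟨S.diagonal_mem i, (Subgroup.eq_bot_iff_forall _).2 ?_,
      (Subgroup.eq_bot_iff_forall _).2 ?_⟩
    · rintro g ⟨x, hx⟩
      have e1 : x = g := congrArg Prod.fst hx
      have e2 : x = 1 := congrArg Prod.snd hx
      exact e1.symm.trans e2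
    · rintro g ⟨x, hx⟩
      have e1 : x = 1 := congrArg Prod.fst hx
      have e2 : x = g := congrArg Prod.snd hx
      exact e2.symm.trans e1

theorem delta_sets_subset (i j : ι) : S.delta.sets i j ⊆ S.sets i j := Set.inter_subset_left

section Aut

theorem graph_mul_mem {i : ι} {U : Subgroup (𝓖 i)} {φ ψ : MulAut U}
    (hφ : graph φ.toMonoidHom ∈ S.sets i i) (hψ : graph ψ.toMonoidHom ∈ S.sets i i) :
    graph (φ * ψ).toMonoidHom ∈ S.sets i i := by
  refine S.mem_of_le (S.star_mem hφ hψ) ?_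
  rintro _ ⟨u, rfl⟩
  exact ⟨ψ u, ⟨ψ u, rfl⟩, ⟨u, rfl⟩⟩

theorem graph_one_mem (i : ι) (U : Subgroup (𝓖 i)) :
    graph (1 : MulAut U).toMonoidHom ∈ S.sets i i := by
  refine S.mem_of_le (S.diagonal_mem i) ?_
  rintro _ ⟨u, rfl⟩
  exact ⟨u, rfl⟩

theorem graph_pow_mem {i : ι} {U : Subgroup (𝓖 i)} {φ : MulAut U}
    (hφ : graph φ.toMonoidHom ∈ S.sets i i) (n : ℕ) :
    graph (φ ^ n).toMonoidHom ∈ S.sets i i := by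
  induction n with
  | zero => exact S.graph_one_mem i U
  | succ n ih =>
    rw [pow_succ]
    exact S.graph_mul_mem ih hφ

variable [∀ i, Finite (𝓖 i)]

/-- The group of automorphisms `φ` of `U ≤ G` with `{(φ u, u) | u ∈ U} ∈ S_{G,G}`. -/
def aut (i : ι) (U : Subgroup (𝓖 i)) : Subgroup (MulAut U) where
  carrier := {φ | graph φ.toMonoidHom ∈ S.sets i i}
  one_mem' := S.graph_one_mem i U
  mul_mem' := S.graph_mul_mem
  inv_mem' := by
    intro φ hφ
    have : Finite (MulAut U) := Finite.of_injective (fun f : MulAut U => (f : U → U))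
      DFunLike.coe_injective
    obtain ⟨n, hn⟩ := (isOfFinOrder_of_finite φ).mem_powers_iff_mem_zpowers.2
      (inv_mem (Subgroup.mem_zpowers φ))
    rw [← hn]
    exact S.graph_pow_mem hφ n

/-- The quotient of `S.aut i U` by the inner automorphisms of `U`. -/
def Out (i : ι) (U : Subgroup (𝓖 i)) : Type u :=
  S.aut i U ⧸ (MulAut.conj : U →* MulAut U).range.subgroupOf (S.aut i U)

end Aut

section Algebra

variable [∀ i, Finite (𝓖 i)]

/-- `B^S(G, H)`. -/
def BS (i j : ι) : AddSubgroup (B (𝓖 i) (𝓖 j)) := BSpan (S.sets i j)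

theorem tensor_mem_BS {i j k : ι} {a : B (𝓖 i) (𝓖 j)} {b : B (𝓖 j) (𝓖 k)}
    (ha : a ∈ S.BS i j) (hb : b ∈ S.BS j k) : B.tensor a b ∈ S.BS i k := by
  induction ha using AddSubgroup.closure_induction with
  | zero => simp
  | add x y _ _ hx hy => simpa using add_mem hx hy
  | neg x _ hx => simpa using neg_mem hx
  | mem x hx =>
    obtain ⟨M, hM, rfl⟩ := hx
    induction hb using AddSubgroup.closure_induction with
    | zero => simp
    | add x y _ _ hx hy => simpa using add_mem hx hy
    | neg x _ hx => simpa using neg_mem hx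
    | mem x hx =>
      obtain ⟨N, hN, rfl⟩ := hx
      rw [B.tensor_cls]
      refine cls_mem_BSpan _ fun z => ?_
      obtain ⟨x, y, rfl⟩ := Biset.tmul_surj z
      rw [stabilizer_tmul]
      obtain ⟨a, ha⟩ := stabilizer_transitive M x
      obtain ⟨b, hb⟩ := stabilizer_transitive N y
      rw [ha, hb]
      exact S.star_mem (S.conj_mem hM a) (S.conj_mem hN b)

theorem one_mem_BS (i : ι) : (1 : B (𝓖 i) (𝓖 i)) ∈ S.BS i i := by
  rw [B.one_def]
  refine cls_mem_BSpan _ fun (x : 𝓖 i) => ?_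
  refine S.mem_of_le (S.conj_mem (S.diagonal_mem i) ((x, 1) : 𝓖 i × 𝓖 i)) ?_
  rintro ⟨g, h⟩ (hgh : g * x * h⁻¹ = x)
  refine ⟨(h, h), ⟨h, rfl⟩, ?_⟩
  refine Prod.ext ?_ ?_
  · change x * h * x⁻¹ = g
    rw [← mul_inv_eq_iff_eq_mul.1 hgh, mul_inv_cancel_right]
  · change 1 * h * (1 : 𝓖 i)⁻¹ = h
    simp

/-- The subring `B^S(G, G)` of the double Burnside ring. -/
noncomputable def BSRing (i : ι) : Subring (B (𝓖 i) (𝓖 i)) where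
  carrier := S.BS i i
  zero_mem' := zero_mem (S.BS i i)
  add_mem' := add_mem (S := AddSubgroup (B (𝓖 i) (𝓖 i)))
  neg_mem' := neg_mem (S := AddSubgroup (B (𝓖 i) (𝓖 i)))
  one_mem' := S.one_mem_BS i
  mul_mem' := S.tensor_mem_BS

/-- The algebra `RB^S(G, G)`, as a subalgebra of `RB(G, G) = R ⊗ B(G, G)`. -/
noncomputable def RBS (R : Type w) [CommRing R] (i : ι) :
    Subalgebra R (R ⊗[ℤ] B (𝓖 i) (𝓖 i)) :=
  (subalgebraOfSubring (S.BSRing i)).baseChange R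

/-- The homogeneous component `RB^S_n(G, G)`. -/
noncomputable def RBSn (R : Type w) [CommRing R] (i : ι) (n : ℕ) :
    Submodule R (R ⊗[ℤ] B (𝓖 i) (𝓖 i)) :=
  Submodule.baseChange R (AddSubgroup.toIntSubmodule (BGraded (S.sets i i) n))

theorem delta_BS_le (i j : ι) : S.delta.BS i j ≤ S.BS i j :=
  AddSubgroup.closure_mono fun _ ⟨M, hM, hx⟩ => ⟨M, S.delta_sets_subset i j hM, hx⟩

theorem delta_RBS_le (R : Type w) [CommRing R] (i : ι) : S.delta.RBS R i ≤ S.RBS R i := by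
  rintro _ ⟨x, rfl⟩
  induction x using TensorProduct.induction_on with
  | zero => rw [map_zero]; exact zero_mem _
  | add x y hx hy => rw [map_add]; exact add_mem hx hy
  | tmul r b => exact Subalgebra.tmul_mem_baseChange (S.delta_BS_le i i b.2) r

/-- The inclusion of the subalgebra `RB^{Δ(S)}(G, G)` into `RB^S(G, G)`. -/
noncomputable def incl (R : Type w) [CommRing R] (i : ι) : S.delta.RBS R i →ₐ[R] S.RBS R i :=
  Subalgebra.inclusion (S.delta_RBS_le R i)

end Algebra

end SubgroupSystem

end Systems

section Simple

/-- Isomorphism of simple left `A`-modules. -/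
def simpleSetoid (A : Type w) [Ring A] : Setoid {M : ModuleCat.{v} A // IsSimpleModule A M} where
  r M N := Nonempty (M.1 ≃ₗ[A] N.1)
  iseqv :=
    { refl := fun _ => ⟨LinearEquiv.refl _ _⟩
      symm := fun ⟨e⟩ => ⟨e.symm⟩
      trans := fun ⟨e⟩ ⟨f⟩ => ⟨e.trans f⟩ }

/-- Isomorphism classes of simple left `A`-modules. -/
def SimpleClass (A : Type w) [Ring A] : Type (max w (v + 1)) :=
  Quotient (simpleSetoid.{v} A)

/-- The isomorphism class of a simple module. -/
def SimpleClass.mk {A : Type w} [Ring A] (M : ModuleCat.{v} A) (hM : IsSimpleModule A M) :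
    SimpleClass.{v} A :=
  Quotient.mk _ ⟨M, hM⟩

end Simple

end DoubleBurnside

/-! Since `|G × G|` is invertible in `R`, an element of `RB^S(G, G)` is determined by its marks. It
is a combination of elements `gluck M`, `M ∈ S_{G,G}`, whose marks are supported on the conjugacy
class of `M` (`mark_gluck`, `card_smul_eq_sum_gluck`). A left-free `M` is the graph of an
epimorphism with kernel isomorphic to `k₂ M`, so `gluck M` is homogeneous of degree `l(k₂ M)`.
Degree zero corresponds to the twisted diagonal subgroups. Hence the sum of the components of
positive degree is the space `J` of elements whose marks vanish at all twisted diagonal subgroups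
(`twistedKernel`, `mem_twistedKernel_iff`). Cutting the expansion down to twisted diagonal subgroups
shows that `J` is a complement of `RB^{Δ(S)}(G, G)`.

Products are governed by the formula `|G| Φ_M(xy) = ∑_γ Φ_{M'}(x) Φ_{M''}(y)` over homomorphisms `γ
: M → G`, with `M' = {(g, γ(g, k))}` and `M'' = {(γ(g, k), k)}` (`card_mul_markR_mul`). Only terms
with `M'` left-free survive. If `M` is twisted diagonal, so are then `M'` and `M''`; thus `J` is a
two-sided ideal and the projection `π` along `J` is multiplicative. For general left-free `M`,
either `M'` is twisted diagonal or `k₂ M''` is strictly smaller than `k₂ M`. Induction on `|k₂ M|`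
then shows that every element of `J` is nilpotent (`isNilpotent_of_mem_twistedKernel`).

A nil ideal annihilates simple modules, so on a simple module `a` and `π a` act alike. Restrictions
along the inclusion and along `π` therefore preserve simplicity and are mutually inverse. -/

namespace DoubleBurnside

open scoped Pointwise

/-! ### Marks of transitive bisets and the integral multiples of the primitive idempotents. -/

section Gluck

variable {G H : Type u} [Group G] [Group H]

theorem B.mark_cls (M : Subgroup (G × H)) (X : Biset G H) :
    B.mark M (B.cls X) = (Nat.card (MulAction.fixedPoints M X.carrier) : ℤ) :=
  B.lift_of _ _

theorem B.cls_congr {X Y : Biset G H} (h : X.Iso Y) : B.cls X = B.cls Y :=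
  congrArg B.of (BisetClass.mk_eq_iff.2 h)

theorem conj_smul_eq_map (a : G × H) (M : Subgroup (G × H)) :
    MulAut.conj a • M = M.map (MulAut.conj a).toMonoidHom := rfl

variable [Finite G] [Finite H]

/-- Right multiplication by `a⁻¹` carries the cosets of `M` to those of `a M a⁻¹`. -/
theorem transitive_conj (M : Subgroup (G × H)) (a : G × H) :
    B.cls (Biset.transitive (MulAut.conj a • M)) = B.cls (Biset.transitive M) := by
  refine (B.cls_congr ?_).symm
  refine ⟨Equiv.ofBijective (Quotient.map' (fun g : G × H => g * a⁻¹) ?_) ⟨?_, ?_⟩, ?_⟩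
  · intro g h hgh
    rw [QuotientGroup.leftRel_apply] at hgh ⊢
    rw [Subgroup.mem_pointwise_smul_iff_inv_smul_mem, ← map_inv]
    simpa [mul_assoc] using hgh
  · rintro ⟨g⟩ ⟨h⟩ hgh
    have := Quotient.exact' hgh
    rw [QuotientGroup.leftRel_apply, Subgroup.mem_pointwise_smul_iff_inv_smul_mem,
      ← map_inv] at this
    refine Quotient.sound' ?_
    rw [QuotientGroup.leftRel_apply]
    simpa [mul_assoc] using this
  · rintro ⟨g⟩
    exact ⟨QuotientGroup.mk (g * a), congrArg QuotientGroup.mk (mul_inv_cancel_right g a)⟩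
  · rintro b ⟨g⟩
    exact congrArg QuotientGroup.mk (mul_assoc b g a⁻¹)

open Classical in
-- The coset `gM` is fixed by `K` iff `g⁻¹ K g ≤ M`. Counting the elements `g` instead of the cosets
-- gives the factor `|M|`, and the substitution `a = g⁻¹` gives the sum.
theorem card_mul_mark_transitive [Fintype (G × H)] (K M : Subgroup (G × H)) :
    (Nat.card M : ℤ) * B.mark K (B.cls (Biset.transitive M)) =
      ∑ a : G × H, if MulAut.conj a • K ≤ M then 1 else 0 := by
  rw [B.mark_cls, Finset.sum_boole, ← Nat.cast_mul, Nat.cast_inj, ← Fintype.card_subtype,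
    ← Nat.card_eq_fintype_card]
  have h := Nat.card_congr (QuotientGroup.preimageMkEquivSubgroupProdSet M
    (MulAction.fixedPoints K ((G × H) ⧸ M)))
  rw [Nat.card_prod] at h
  refine h.symm.trans (Nat.card_congr ((Equiv.inv (G × H)).subtypeEquiv fun g => ?_))
  change (∀ k : K, ((k : G × H) • (QuotientGroup.mk g : (G × H) ⧸ M)) = QuotientGroup.mk g) ↔ _
  rw [Equiv.inv_apply, map_inv]
  constructor
  · intro hk x hx
    rw [Subgroup.mem_pointwise_smul_iff_inv_smul_mem, inv_inv] at hx
    have := QuotientGroup.eq.1 (hk ⟨_, hx⟩).symm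
    simpa [mul_assoc] using this
  · intro hM k
    refine (QuotientGroup.eq.2 ?_).symm
    have := hM (Subgroup.smul_mem_pointwise_smul _ (MulAut.conj g)⁻¹ K k.2)
    rw [← map_inv] at this
    simpa [mul_assoc] using this

/-- The multiple of the primitive idempotent of the Burnside ring at `M` whose mark at `K` is the
number of elements conjugating `K` to `M`. -/
noncomputable def gluck (M : Subgroup (G × H)) : B G H :=
  Nat.card M • B.cls (Biset.transitive M) - ∑ᶠ N : Set.Iio M, gluck N.1
termination_by Nat.card M
decreasing_by
  exact Set.ncard_lt_ncard (SetLike.coe_ssubset_coe.2 N.2) (Set.toFinite _)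

open Classical in
theorem gluck_eq [Fintype (Subgroup (G × H))] (M : Subgroup (G × H)) :
    gluck M = Nat.card M • B.cls (Biset.transitive M) -
      ∑ N : Subgroup (G × H), (if N < M then gluck N else 0) := by
  rw [gluck, finsum_eq_sum_of_fintype, ← Finset.sum_filter]
  congr 1
  exact (Finset.sum_subtype _ (fun N => by simp) _).symm

open Classical in
theorem sum_gluck [Fintype (Subgroup (G × H))] (M : Subgroup (G × H)) :
    ∑ N : Subgroup (G × H), (if N ≤ M then gluck N else 0) =
      Nat.card M • B.cls (Biset.transitive M) := by
  have h := gluck_eq M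
  rw [eq_sub_iff_add_eq, ← Finset.sum_filter] at h
  rw [← h, ← Finset.sum_filter]
  have e : Finset.univ.filter (fun N => N ≤ M) =
      insert M (Finset.univ.filter fun N => N < M) := by
    ext N
    simp [le_iff_eq_or_lt]
  rw [e, Finset.sum_insert (by simp)]

theorem gluck_induction {p : Subgroup (G × H) → Prop}
    (h : ∀ M, (∀ N < M, p N) → p M) (M) : p M :=
  WellFoundedLT.induction (motive := p) M h

open Classical in
-- Möbius inversion of `card_mul_mark_transitive` over the subgroup lattice. In particular the mark
-- at `K` is zero unless `K` and `M` are conjugate.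
theorem mark_gluck [Fintype (G × H)] (K M : Subgroup (G × H)) :
    B.mark K (gluck M) = ∑ a : G × H, if MulAut.conj a • K = M then 1 else 0 := by
  have : Fintype (Subgroup (G × H)) := Fintype.ofFinite _
  induction M using gluck_induction with
  | _ M ih =>
    rw [gluck_eq, map_sub, map_nsmul, nsmul_eq_mul, card_mul_mark_transitive, map_sum,
      sub_eq_iff_eq_add]
    have h1 : ∀ N : Subgroup (G × H), B.mark K (if N < M then gluck N else 0) =
        ∑ a : G × H, if MulAut.conj a • K = N ∧ N < M then 1 else 0 := by
      intro N
      by_cases hN : N < M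
      · simp [hN, ih N hN]
      · simp [hN]
    simp only [h1]
    rw [Finset.sum_comm, ← Finset.sum_add_distrib]
    refine Finset.sum_congr rfl fun a _ => ?_
    -- For fixed `a` only `N = a K a⁻¹` contributes, so the claim becomes the splitting of `a K a⁻¹
    -- ≤ M` into equality and strict inclusion.
    have h2 : ∀ N, (if MulAut.conj a • K = N ∧ N < M then (1 : ℤ) else 0) =
        if MulAut.conj a • K = N then (if MulAut.conj a • K < M then 1 else 0) else 0 := by
      intro N
      by_cases hN : MulAut.conj a • K = N
      · subst hN; simp
      · simp [hN]
    simp only [h2, Finset.sum_ite_eq, Finset.mem_univ, if_true]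
    by_cases h3 : MulAut.conj a • K = M
    · simp [h3]
    · simp [h3, le_iff_eq_or_lt]

theorem gluck_conj (M : Subgroup (G × H)) (a : G × H) : gluck (MulAut.conj a • M) = gluck M := by
  classical
  have : Fintype (Subgroup (G × H)) := Fintype.ofFinite _
  induction M using gluck_induction with
  | _ M ih =>
    rw [gluck_eq, gluck_eq M, transitive_conj,
      ← Nat.card_congr (Subgroup.equivSMul (MulAut.conj a) M).toEquiv]
    congr 1
    refine (Fintype.sum_equiv (MulAction.toPerm (MulAut.conj a)) _ _ fun N => ?_).symm
    rw [MulAction.toPerm_apply]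
    have h : MulAut.conj a • N < MulAut.conj a • M ↔ N < M := by
      rw [lt_iff_le_not_ge, lt_iff_le_not_ge, Subgroup.pointwise_smul_le_pointwise_smul_iff,
        Subgroup.pointwise_smul_le_pointwise_smul_iff]
    by_cases hN : N < M
    · rw [if_pos hN, if_pos (h.2 hN), ih N hN]
    · rw [if_neg hN, if_neg (mt h.1 hN)]

theorem gluck_mem_BSpan {T : Set (Subgroup (G × H))}
    (hT : ∀ M ∈ T, ∀ N ≤ M, N ∈ T) (M : Subgroup (G × H)) (hM : M ∈ T) : gluck M ∈ BSpan T := by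
  classical
  have : Fintype (Subgroup (G × H)) := Fintype.ofFinite _
  induction M using gluck_induction with
  | _ M ih =>
    rw [gluck_eq]
    have h : B.cls (Biset.transitive M) ∈ BSpan T := AddSubgroup.subset_closure ⟨M, hM, rfl⟩
    refine sub_mem (nsmul_mem h _) (sum_mem fun N _ => ?_)
    split_ifs with hN
    · exact ih N hN (hT M hM N hN.le)
    · exact zero_mem _

/-- The expansion of a multiple of `[(G × H) / M]` in terms of its marks. -/
theorem card_mul_transitive [Fintype (Subgroup (G × H))] (M : Subgroup (G × H)) :
    (Nat.card M : ℤ) • (Nat.card (G × H) : ℤ) • B.cls (Biset.transitive M) =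
      (Nat.card M : ℤ) • ∑ K : Subgroup (G × H),
        B.mark K (B.cls (Biset.transitive M)) • gluck K := by
  classical
  have : Fintype (G × H) := Fintype.ofFinite _
  rw [Finset.smul_sum]
  simp only [smul_smul, card_mul_mark_transitive, Finset.sum_smul]
  rw [Finset.sum_comm]
  -- The factor `|M|` on both sides lets the mark be replaced by a count without dividing. After
  -- interchanging the sums, conjugation by `a` permutes the subgroups and fixes the `gluck`
  -- elements, so each `a` contributes the same sum over `N ≤ M`.
  have h : ∀ a : G × H, ∑ K : Subgroup (G × H),
      (if MulAut.conj a • K ≤ M then (1 : ℤ) else 0) • gluck K =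
        (Nat.card M : ℤ) • B.cls (Biset.transitive M) := by
    intro a
    rw [natCast_zsmul, ← sum_gluck]
    refine Fintype.sum_equiv (MulAction.toPerm (MulAut.conj a)) _ _ fun N => ?_
    rw [MulAction.toPerm_apply, gluck_conj, ite_smul, one_smul, zero_smul]
  simp only [h]
  rw [Finset.sum_const, Finset.card_univ, ← Nat.card_eq_fintype_card, mul_comm, mul_smul,
    natCast_zsmul]

end Gluck

/-! ### Extension of scalars: marks with values in `R`. -/

section BaseChange

variable {G H : Type u} [Group G] [Group H] (R : Type w) [CommRing R]

/-- The `R`-linear extension of the mark at `M` to `R ⊗ B(G, H)`. -/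
noncomputable def markR (M : Subgroup (G × H)) : R ⊗[ℤ] B G H →ₗ[R] R :=
  (TensorProduct.AlgebraTensorModule.rid ℤ R R).toLinearMap ∘ₗ
    (B.mark M).toIntLinearMap.baseChange R

theorem markR_tmul (M : Subgroup (G × H)) (r : R) (b : B G H) :
    markR R M (r ⊗ₜ b) = (B.mark M b : R) * r := by
  simp [markR, TensorProduct.AlgebraTensorModule.rid_tmul]

variable [Finite G] [Finite H]

/-- The `R`-span of the classes `[(G × H) / M]`, `M ∈ T`. -/
noncomputable def RSpan (T : Set (Subgroup (G × H))) : Submodule R (R ⊗[ℤ] B G H) :=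
  Submodule.span R ((fun M => (1 : R) ⊗ₜ[ℤ] B.cls (Biset.transitive M)) '' T)

theorem tmul_mem_RSpan {T : Set (Subgroup (G × H))} {b : B G H} (hb : b ∈ BSpan T) (r : R) :
    r ⊗ₜ b ∈ RSpan R T := by
  suffices h : (1 : R) ⊗ₜ[ℤ] b ∈ RSpan R T by
    simpa [TensorProduct.smul_tmul'] using (RSpan R T).smul_mem r h
  induction hb using AddSubgroup.closure_induction with
  | zero => rw [TensorProduct.tmul_zero]; exact zero_mem _
  | add x y _ _ hx hy => rw [TensorProduct.tmul_add]; exact add_mem hx hy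
  | neg x _ hx => rw [TensorProduct.tmul_neg]; exact neg_mem hx
  | mem x hx =>
    obtain ⟨M, hM, rfl⟩ := hx
    exact Submodule.subset_span ⟨M, hM, rfl⟩

theorem isUnit_card_subgroup {Γ : Type u} [Group Γ] [Finite Γ] (M : Subgroup Γ)
    (h : IsUnit (Nat.card Γ : R)) : IsUnit (Nat.card M : R) :=
  isUnit_of_dvd_unit (Nat.cast_dvd_cast M.card_subgroup_dvd_card) h

/-- An element of `R ⊗ B(G, H)` is determined by its marks if `|G × H|` is invertible. -/
theorem card_smul_eq_sum_gluck [Fintype (Subgroup (G × H))]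
    (h : IsUnit (Nat.card (G × H) : R)) {T : Set (Subgroup (G × H))} {x : R ⊗[ℤ] B G H}
    (hx : x ∈ RSpan R T) :
    (Nat.card (G × H) : R) • x =
      ∑ K : Subgroup (G × H), markR R K x • ((1 : R) ⊗ₜ[ℤ] gluck K) := by
  induction hx using Submodule.span_induction with
  | zero => simp
  | add x y _ _ hx hy => rw [smul_add, hx, hy]; simp [add_smul, Finset.sum_add_distrib]
  | smul r x _ hx => rw [smul_comm, hx]; simp [Finset.smul_sum, smul_smul]
  | mem x hx =>
    obtain ⟨M, hM, rfl⟩ := hx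
    -- The integral identity carries an extra factor `|M|`; it divides `|G × H|`, hence is a unit in
    -- `R`.
    refine (isUnit_card_subgroup R M h).smul_left_cancel.1 ?_
    have e := congrArg (fun b => (1 : R) ⊗ₜ[ℤ] b) (card_mul_transitive M)
    have k : ∀ (n : ℤ) (b : B G H), (1 : R) ⊗ₜ[ℤ] (n • b) = (n : R) • ((1 : R) ⊗ₜ[ℤ] b) := by
      intro n b
      rw [TensorProduct.tmul_smul, Int.cast_smul_eq_zsmul]
    simp only [k, TensorProduct.tmul_sum, Int.cast_natCast] at e
    simpa only [markR_tmul, mul_one] using e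

/-- A point of `(G × H) / M` fixed by `K` puts `K` inside a conjugate of `M`, hence inside `T`. -/
theorem markR_eq_zero {T : Set (Subgroup (G × H))}
    (hconj : ∀ M ∈ T, ∀ a : G × H, MulAut.conj a • M ∈ T) (hle : ∀ M ∈ T, ∀ N ≤ M, N ∈ T)
    {x : R ⊗[ℤ] B G H} (hx : x ∈ RSpan R T) {K : Subgroup (G × H)} (hK : K ∉ T) :
    markR R K x = 0 := by
  induction hx using Submodule.span_induction with
  | zero => simp
  | add x y _ _ hx hy => simp [hx, hy]
  | smul r x _ hx => simp [hx]
  | mem x hx =>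
    obtain ⟨M, hM, rfl⟩ := hx
    have : IsEmpty (MulAction.fixedPoints K (Biset.transitive M).carrier) := by
      refine ⟨fun y => hK ?_⟩
      obtain ⟨a, ha⟩ := stabilizer_transitive M y.1
      refine hle _ (hconj M hM a) K ?_
      rw [conj_smul_eq_map, ← ha]
      exact fun k hk => y.2 ⟨k, hk⟩
    simp only [markR_tmul, B.mark_cls]
    simp

end BaseChange

/-! ### Marks of a product of bisets, and the kernels of the two factors. -/

section Product

variable {G H K : Type u} [Group G] [Group H] [Group K]

/-- The subgroup `{(g, γ (g, k)) | (g, k) ∈ M}`. -/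
def leftFactor (M : Subgroup (G × K)) (γ : M →* H) : Subgroup (G × H) :=
  (((MonoidHom.fst G K).comp M.subtype).prod γ).range

/-- The subgroup `{(γ (g, k), k) | (g, k) ∈ M}`. -/
def rightFactor (M : Subgroup (G × K)) (γ : M →* H) : Subgroup (H × K) :=
  (γ.prod ((MonoidHom.snd G K).comp M.subtype)).range

theorem leftFactor_le_iff {M : Subgroup (G × K)} {γ : M →* H} {N : Subgroup (G × H)} :
    leftFactor M γ ≤ N ↔ ∀ m : M, (m.1.1, γ m) ∈ N :=
  ⟨fun h m => h ⟨m, rfl⟩, by rintro h _ ⟨m, rfl⟩; exact h m⟩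

theorem rightFactor_le_iff {M : Subgroup (G × K)} {γ : M →* H} {N : Subgroup (H × K)} :
    rightFactor M γ ≤ N ↔ ∀ m : M, (γ m, m.1.2) ∈ N :=
  ⟨fun h m => h ⟨m, rfl⟩, by rintro h _ ⟨m, rfl⟩; exact h m⟩

theorem mem_fixedPoints_iff_le {Γ : Type u} {X : Type v} [Group Γ] [MulAction Γ X]
    {M : Subgroup Γ} {x : X} : x ∈ MulAction.fixedPoints M X ↔ M ≤ MulAction.stabilizer Γ x :=
  ⟨fun h m hm => h ⟨m, hm⟩, fun h m => h m.2⟩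

/-- The first component of an element is determined by the second if `N` is left-free. -/
theorem eq_of_k₁_eq_bot {N : Subgroup (H × K)} (hN : k₁ N = ⊥) {h h' : H} {k : K}
    (h1 : (h, k) ∈ N) (h2 : (h', k) ∈ N) : h = h' := by
  have : (h * h'⁻¹, (1 : K)) ∈ N := by
    have := N.mul_mem h1 (N.inv_mem h2)
    rwa [Prod.inv_mk, Prod.mk_mul_mk, mul_inv_cancel] at this
  exact mul_inv_eq_one.1 ((Subgroup.eq_bot_iff_forall _).1 hN _ this)

/-- A subgroup of a composition of relations, the second of which is left-free, factors through
a unique homomorphism. -/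
theorem le_star_iff {M : Subgroup (G × K)} {N : Subgroup (G × H)} {P : Subgroup (H × K)}
    (hP : k₁ P = ⊥) :
    M ≤ star N P ↔ ∃ γ : M →* H, leftFactor M γ ≤ N ∧ rightFactor M γ ≤ P := by
  constructor
  · intro h
    choose f hf using fun m : M => mem_star.1 (h m.2)
    refine ⟨MonoidHom.mk' f fun m m' => eq_of_k₁_eq_bot hP (hf _).2
      (P.mul_mem (hf m).2 (hf m').2), ?_, ?_⟩
    · exact leftFactor_le_iff.2 fun m => (hf m).1
    · exact rightFactor_le_iff.2 fun m => (hf m).2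
  · rintro ⟨γ, h1, h2⟩ m hm
    exact ⟨γ ⟨m, hm⟩, leftFactor_le_iff.1 h1 ⟨m, hm⟩, rightFactor_le_iff.1 h2 ⟨m, hm⟩⟩

/-- Bisets all of whose stabilizers are left-free. -/
def Biset.LeftFree (X : Biset G H) : Prop :=
  ∀ x : X.carrier, k₁ (MulAction.stabilizer (G × H) x) = ⊥

/-- The fibres of `X × Y → X ×_H Y` are `H`-orbits. As `H` acts freely on `Y`, each is a copy of
`H`, translated from a chosen representative `(r z, s z)`. -/
theorem card_mul_card_fixedPoints_tensor (X : Biset G H) (Y : Biset H K) (hY : Y.LeftFree)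
    (M : Subgroup (G × K)) :
    Nat.card H * Nat.card (MulAction.fixedPoints M (X.tensor Y).carrier) =
      Nat.card {p : X.carrier × Y.carrier //
        X.tmul Y p.1 p.2 ∈ MulAction.fixedPoints M (X.tensor Y).carrier} := by
  choose r s hrs using fun z : (X.tensor Y).carrier => Biset.tmul_surj z
  rw [← Nat.card_prod]
  have key : ∀ (h : H) (z : (X.tensor Y).carrier),
      X.tmul Y (((1, h) : G × H) • r z) (((h, 1) : H × K) • s z) = z := fun h z =>
    (Biset.tmul_eq_iff.2 ⟨h, rfl, rfl⟩).symm.trans (hrs z)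
  refine Nat.card_congr (Equiv.ofBijective
    (fun p => ⟨(((1, p.1) : G × H) • r p.2.1, ((p.1, 1) : H × K) • s p.2.1),
      by rw [key]; exact p.2.2⟩) ⟨?_, ?_⟩)
  · rintro ⟨h, z, hz⟩ ⟨h', z', hz'⟩ e
    have e1 := congrArg (fun p => p.1.1) e
    have e2 := congrArg (fun p => p.1.2) e
    dsimp only at e1 e2
    have ez : z = z' := by rw [← key h z, e1, e2, key]
    subst ez
    have : h'⁻¹ * h = 1 := by
      refine (Subgroup.eq_bot_iff_forall _).1 (hY (s z)) _ ?_
      change ((h'⁻¹ * h, 1) : H × K) • s z = s z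
      have e3 : ((h'⁻¹ * h, 1) : H × K) = (h', 1)⁻¹ * (h, 1) := by simp
      rw [e3, mul_smul, e2, inv_smul_smul]
    rw [inv_mul_eq_one] at this
    rw [this]
  · rintro ⟨⟨x, y⟩, hxy⟩
    obtain ⟨h, h1, h2⟩ := Biset.tmul_eq_iff.1 (hrs (X.tmul Y x y))
    exact ⟨⟨h, _, hxy⟩, Subtype.ext (Prod.ext h1 h2)⟩

/-- The marks of a tensor product. -/
theorem card_mul_mark_tensor [Finite H] (X : Biset G H) (Y : Biset H K) (hY : Y.LeftFree)
    (M : Subgroup (G × K)) [Fintype (M →* H)] :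
    (Nat.card H : ℤ) * B.mark M (B.cls (X.tensor Y)) =
      ∑ γ : M →* H, B.mark (leftFactor M γ) (B.cls X) * B.mark (rightFactor M γ) (B.cls Y) := by
  simp only [B.mark_cls]
  rw [← Nat.cast_mul, card_mul_card_fixedPoints_tensor X Y hY]
  simp only [← Nat.cast_mul, ← Nat.cast_sum, ← Nat.card_prod]
  rw [← Nat.card_sigma, Nat.cast_inj]
  symm
  -- `M` fixes `x ×_H y` iff each `(g, k) ∈ M` admits an `h` with `(g, h)` stabilizing `x` and `(h,
  -- k)` stabilizing `y`. Left-freeness makes `h` unique, so `(g, k) ↦ h` is a homomorphism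
  -- determined by `y`, and the fixed pairs are partitioned by it.
  have hmem : ∀ x y, X.tmul Y x y ∈ MulAction.fixedPoints M (X.tensor Y).carrier ↔
      ∃ γ : M →* H, leftFactor M γ ≤ MulAction.stabilizer (G × H) x ∧
        rightFactor M γ ≤ MulAction.stabilizer (H × K) y := by
    intro x y
    rw [mem_fixedPoints_iff_le, stabilizer_tmul, le_star_iff (hY y)]
  refine Nat.card_congr (Equiv.ofBijective (fun q => ⟨(q.2.1.1, q.2.2.1), (hmem _ _).2
    ⟨q.1, mem_fixedPoints_iff_le.1 q.2.1.2, mem_fixedPoints_iff_le.1 q.2.2.2⟩⟩) ⟨?_, ?_⟩)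
  · rintro ⟨γ, ⟨x, hx⟩, ⟨y, hy⟩⟩ ⟨γ', ⟨x', hx'⟩, ⟨y', hy'⟩⟩ e
    have e1 : x = x' := congrArg (fun p => p.1.1) e
    have e2 : y = y' := congrArg (fun p => p.1.2) e
    subst e1 e2
    have : γ = γ' := MonoidHom.ext fun m => eq_of_k₁_eq_bot (hY y)
      (rightFactor_le_iff.1 (mem_fixedPoints_iff_le.1 hy) m)
      (rightFactor_le_iff.1 (mem_fixedPoints_iff_le.1 hy') m)
    subst this
    rfl
  · rintro ⟨⟨x, y⟩, hxy⟩
    obtain ⟨γ, h1, h2⟩ := (hmem x y).1 hxy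
    exact ⟨⟨γ, ⟨x, mem_fixedPoints_iff_le.2 h1⟩, ⟨y, mem_fixedPoints_iff_le.2 h2⟩⟩, rfl⟩

theorem k₁_map_conj {M : Subgroup (G × H)} (hM : k₁ M = ⊥) (a : G × H) :
    k₁ (M.map (MulAut.conj a).toMonoidHom) = ⊥ := by
  refine (Subgroup.eq_bot_iff_forall _).2 ?_
  rintro g ⟨⟨m, n⟩, hm, hg⟩
  have e1 : a.1 * m * a.1⁻¹ = g := congrArg Prod.fst hg
  have e2 : a.2 * n * a.2⁻¹ = 1 := congrArg Prod.snd hg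
  rw [conj_eq_one_iff] at e2
  subst e2
  have : m = 1 := (Subgroup.eq_bot_iff_forall _).1 hM m hm
  rw [← e1, this]
  simp

/-- The marks of a product in `R ⊗ B(G, G)`. -/
theorem card_mul_markR_mul (R : Type w) [CommRing R] [Finite G]
    {T T' : Set (Subgroup (G × G))} (hT : T' ⊆ leftFreeSubgroups G G)
    {x y : R ⊗[ℤ] B G G} (hx : x ∈ RSpan R T) (hy : y ∈ RSpan R T') (M : Subgroup (G × G))
    [Fintype (M →* G)] :
    (Nat.card G : R) * markR R M (x * y) =
      ∑ γ : M →* G, markR R (leftFactor M γ) x * markR R (rightFactor M γ) y := by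
  induction hx using Submodule.span_induction with
  | zero => simp
  | add x x' _ _ h h' =>
    rw [add_mul, map_add, mul_add, h, h', ← Finset.sum_add_distrib]
    simp only [map_add, add_mul]
  | smul r x _ h =>
    rw [smul_mul_assoc, map_smul, smul_eq_mul, mul_left_comm, h, Finset.mul_sum]
    simp only [map_smul, smul_eq_mul, mul_assoc]
  | mem x hx =>
    obtain ⟨N, -, rfl⟩ := hx
    induction hy using Submodule.span_induction with
    | zero => simp
    | add y y' _ _ h h' =>
      rw [mul_add, map_add, mul_add, h, h', ← Finset.sum_add_distrib]
      simp only [map_add, mul_add]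
    | smul r y _ h =>
      rw [mul_smul_comm, map_smul, smul_eq_mul, mul_left_comm, h, Finset.mul_sum]
      simp only [map_smul, smul_eq_mul, mul_left_comm]
    | mem y hy =>
      obtain ⟨P, hP, rfl⟩ := hy
      have hfree : (Biset.transitive P).LeftFree := by
        intro z
        obtain ⟨a, ha⟩ := stabilizer_transitive P z
        rw [ha]
        exact k₁_map_conj (hT hP) a
      have h := congrArg (Int.cast (R := R))
        (card_mul_mark_tensor (Biset.transitive N) (Biset.transitive P) hfree M)
      simp only [Algebra.TensorProduct.tmul_mul_tmul, markR_tmul, mul_one, B.mul_def,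
        B.tensor_cls]
      push_cast at h
      exact h

theorem k₁_rightFactor {M : Subgroup (G × K)} (hM : k₁ M = ⊥) (γ : M →* H) :
    k₁ (rightFactor M γ) = ⊥ := by
  refine (Subgroup.eq_bot_iff_forall _).2 ?_
  rintro h ⟨⟨⟨g, k⟩, hm⟩, e⟩
  have e1 : γ ⟨(g, k), hm⟩ = h := congrArg Prod.fst e
  have e2 : k = 1 := congrArg Prod.snd e
  subst e2
  have e3 : g = 1 := (Subgroup.eq_bot_iff_forall _).1 hM g hm
  subst e3
  rw [← e1]
  exact map_one γ

/-- If both factors are left-free and the left one is not right-free, the right factor has a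
smaller right kernel. -/
theorem card_k₂_rightFactor_lt [Finite K] {M : Subgroup (G × K)} {γ : M →* H}
    (h1 : k₁ (leftFactor M γ) = ⊥) (h2 : k₂ (leftFactor M γ) ≠ ⊥) :
    Nat.card (k₂ (rightFactor M γ)) < Nat.card (k₂ M) := by
  refine Set.ncard_lt_ncard (s := (k₂ (rightFactor M γ) : Set K)) (t := (k₂ M : Set K)) ?_
    (Set.toFinite _)
  refine SetLike.coe_ssubset_coe.2 (lt_of_le_of_ne ?_ ?_)
  -- If `γ (g, k) = 1`, then `(g, 1)` lies in the left factor, which forces `g = 1`.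
  · rintro k ⟨⟨⟨g, k'⟩, hm⟩, e⟩
    have e1 : γ ⟨(g, k'), hm⟩ = 1 := congrArg Prod.fst e
    have e2 : k' = k := congrArg Prod.snd e
    subst e2
    have e3 : g = 1 := (Subgroup.eq_bot_iff_forall _).1 h1 g ⟨⟨(g, k'), hm⟩, Prod.ext rfl e1⟩
    subst e3
    exact hm
  -- Equality of the right kernels would make `γ` trivial on `1 × k₂ M`. The image of that subgroup
  -- under `γ` is the right kernel of the left factor, assumed nontrivial.
  · intro h
    refine h2 ((Subgroup.eq_bot_iff_forall _).2 ?_)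
    rintro y ⟨⟨⟨g, k⟩, hm⟩, e⟩
    have e1 : g = 1 := congrArg Prod.fst e
    have e2 : γ ⟨(g, k), hm⟩ = y := congrArg Prod.snd e
    subst e1
    have hk : k ∈ k₂ (rightFactor M γ) := h ▸ hm
    obtain ⟨⟨⟨g', k'⟩, hm'⟩, e'⟩ := hk
    have e3 : γ ⟨(g', k'), hm'⟩ = 1 := congrArg Prod.fst e'
    have e4 : k' = k := congrArg Prod.snd e'
    subst e4
    have e5 : g' = 1 :=
      (Subgroup.eq_bot_iff_forall _).1 h1 g' ⟨⟨(g', k'), hm'⟩, Prod.ext rfl e3⟩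
    subst e5
    exact e2.symm.trans e3

/-- The right factor of a right-free relation is right-free if the left one is left-free. -/
theorem k₂_rightFactor_eq_bot {M : Subgroup (G × K)} (h2 : k₂ M = ⊥) {γ : M →* H}
    (hl : k₁ (leftFactor M γ) = ⊥) : k₂ (rightFactor M γ) = ⊥ := by
  refine (Subgroup.eq_bot_iff_forall _).2 ?_
  rintro k ⟨⟨⟨g, k'⟩, hm⟩, e⟩
  have e1 : γ ⟨(g, k'), hm⟩ = 1 := congrArg Prod.fst e
  have e2 : k' = k := congrArg Prod.snd e
  subst e2
  have e3 : g = 1 := (Subgroup.eq_bot_iff_forall _).1 hl g ⟨⟨(g, k'), hm⟩, Prod.ext rfl e1⟩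
  subst e3
  exact (Subgroup.eq_bot_iff_forall _).1 h2 k' hm

theorem k₂_leftFactor_eq_bot {M : Subgroup (G × K)} (h2 : k₂ M = ⊥) (γ : M →* H) :
    k₂ (leftFactor M γ) = ⊥ := by
  refine (Subgroup.eq_bot_iff_forall _).2 ?_
  rintro h ⟨⟨⟨g, k⟩, hm⟩, e⟩
  have e1 : g = 1 := congrArg Prod.fst e
  have e2 : γ ⟨(g, k), hm⟩ = h := congrArg Prod.snd e
  subst e1
  have e3 : k = 1 := (Subgroup.eq_bot_iff_forall _).1 h2 k hm
  subst e3
  rw [← e2]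
  exact map_one γ

end Product

/-! ### Composition length: isomorphism invariance and length zero. -/

section CompositionLength

theorem HasCompositionSeries.of_mulEquiv {K L : Type u} [Group K] [Group L] (e : K ≃* L) {n : ℕ}
    (h : HasCompositionSeries K n) : HasCompositionSeries L n := by
  obtain ⟨s, h0, h1, hs⟩ := h
  refine ⟨fun i => (s i).map e.toMonoidHom, ?_, ?_, fun i => ?_⟩
  · change (s 0).map _ = ⊥
    rw [h0, Subgroup.map_bot]
  · change (s (Fin.last n)).map _ = ⊤
    rw [h1]
    exact Subgroup.map_top_of_surjective _ e.surjective
  · obtain ⟨hle, hn, hsimple⟩ := hs i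
    refine ⟨Subgroup.map_mono hle, ?_⟩
    let f : s i.succ ≃* (s i.succ).map e.toMonoidHom := e.subgroupMap (s i.succ)
    have hf : ((s i.castSucc).subgroupOf (s i.succ)).map f.toMonoidHom =
        ((s i.castSucc).map e.toMonoidHom).subgroupOf ((s i.succ).map e.toMonoidHom) := by
      ext ⟨x, hx⟩
      constructor
      · rintro ⟨y, hy, hyx⟩
        exact ⟨y, hy, congrArg Subtype.val hyx⟩
      · rintro ⟨y, hy, hyx⟩
        exact ⟨⟨y, hle hy⟩, hy, Subtype.ext hyx⟩
    have hn' := hn.map f.toMonoidHom f.surjective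
    rw [hf] at hn'
    exact ⟨hn', (QuotientGroup.congr _ _ f hf).symm.isSimpleGroup⟩

theorem compositionLength_congr {K L : Type u} [Group K] [Group L] (e : K ≃* L) :
    compositionLength K = compositionLength L := by
  have : ∀ n, HasCompositionSeries K n ↔ HasCompositionSeries L n := fun n =>
    ⟨.of_mulEquiv e, .of_mulEquiv e.symm⟩
  simp only [compositionLength, this]

/-- Every subgroup of a finite group is the end of a subnormal series with simple quotients. -/
theorem exists_series {K : Type u} [Group K] [Finite K] (H : Subgroup K) :
    ∃ n, ∃ s : Fin (n + 1) → Subgroup K, s 0 = ⊥ ∧ s (Fin.last n) = H ∧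
      ∀ i : Fin n, s i.castSucc ≤ s i.succ ∧
        ∃ _ : ((s i.castSucc).subgroupOf (s i.succ)).Normal,
          IsSimpleGroup (s i.succ ⧸ (s i.castSucc).subgroupOf (s i.succ)) := by
  induction H using WellFoundedLT.induction with
  | _ H ih =>
  by_cases hH : H = ⊥
  · exact ⟨0, fun _ => ⊥, rfl, hH.symm, fun i => i.elim0⟩
  -- A maximal proper normal subgroup `N` of `H` has simple quotient; a series for `N` is then
  -- extended by `H`.
  · obtain ⟨N, ⟨hNlt, hNn⟩, hmax⟩ := Set.Finite.exists_maximal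
      (s := {N : Subgroup K | N < H ∧ (N.subgroupOf H).Normal}) (Set.toFinite _)
      ⟨⊥, bot_lt_iff_ne_bot.2 hH, by rw [Subgroup.bot_subgroupOf]; infer_instance⟩
    obtain ⟨n, s, h0, h1, hs⟩ := ih N hNlt
    have hsimple : IsSimpleGroup (H ⧸ N.subgroupOf H) := by
      have hnt : Nontrivial (H ⧸ N.subgroupOf H) := by
        rw [QuotientGroup.nontrivial_iff, Ne, Subgroup.subgroupOf_eq_top]
        exact hNlt.not_ge
      refine { eq_bot_or_eq_top_of_normal := fun M hM => ?_ }
      let M' := M.comap (QuotientGroup.mk' (N.subgroupOf H))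
      have hM' : M'.Normal := hM.comap _
      have hsub : (M'.map H.subtype).subgroupOf H = M' :=
        Subgroup.comap_map_eq_self_of_injective H.subtype_injective M'
      have hNM : N ≤ M'.map H.subtype := fun k hk => by
        refine ⟨⟨k, hNlt.le hk⟩, ?_, rfl⟩
        change QuotientGroup.mk' (N.subgroupOf H) _ ∈ M
        have : QuotientGroup.mk' (N.subgroupOf H) ⟨k, hNlt.le hk⟩ = 1 :=
          (QuotientGroup.eq_one_iff _).2 hk
        rw [this]
        exact M.one_mem
      by_cases htop : M'.map H.subtype = H
      · right
        have h2 : M' = ⊤ := by rw [← hsub, htop, Subgroup.subgroupOf_self]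
        refine (Subgroup.eq_top_iff' _).2 fun q => ?_
        obtain ⟨q, rfl⟩ := QuotientGroup.mk'_surjective _ q
        have : q ∈ M' := h2 ▸ Subgroup.mem_top q
        exact this
      · left
        have hle := hmax ⟨lt_of_le_of_ne (Subgroup.map_subtype_le M') htop, by
          rw [hsub]; exact hM'⟩ hNM
        refine (Subgroup.eq_bot_iff_forall _).2 fun q hq => ?_
        obtain ⟨q, rfl⟩ := QuotientGroup.mk'_surjective _ q
        exact (QuotientGroup.eq_one_iff _).2 (hle ⟨q, hq, rfl⟩)
    refine ⟨n + 1, Fin.snoc (α := fun _ => Subgroup K) s H, ?_, Fin.snoc_last _ _, fun i => ?_⟩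
    · exact (Fin.snoc_castSucc (α := fun _ => Subgroup K) H s 0).trans h0
    · refine Fin.lastCases ?_ (fun j => ?_) i
      · rw [Fin.succ_last, Fin.snoc_last, Fin.snoc_castSucc, h1]
        exact ⟨hNlt.le, hNn, hsimple⟩
      · rw [Fin.succ_castSucc, Fin.snoc_castSucc, Fin.snoc_castSucc]
        exact hs j

/-- As `sInf ∅ = 0`, length zero could also mean that no series exists; `exists_series` rules this
out. Together with isomorphism invariance this is all that is needed about lengths, so Jordan–Hölder
plays no role. -/
theorem compositionLength_eq_zero_iff {K : Type u} [Group K] [Finite K] :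
    compositionLength K = 0 ↔ Subsingleton K := by
  rw [compositionLength, Nat.sInf_eq_zero]
  constructor
  · rintro (⟨s, h0, h1, -⟩ | h)
    · exact (Subgroup.subsingleton_iff).1 (subsingleton_of_bot_eq_top (h0.symm.trans h1))
    · obtain ⟨n, hn⟩ := exists_series (⊤ : Subgroup K)
      exact (Set.eq_empty_iff_forall_notMem.1 h n hn).elim
  · exact fun h => Or.inl ⟨fun _ => ⊥, rfl, Subsingleton.elim _ _, fun i => i.elim0⟩

end CompositionLength

/-! ### Left-free subgroups as graphs; homogeneity of `gluck M`. -/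

section Graph

variable {G H : Type u} [Group G] [Group H]

theorem exists_graph_eq {M : Subgroup (G × H)} (hM : k₁ M = ⊥) :
    ∃ (U : Subgroup G) (V : Subgroup H) (α : V →* U), Function.Surjective α ∧ graph α = M := by
  let U := M.map (MonoidHom.fst G H)
  let V := M.map (MonoidHom.snd G H)
  have hV : ∀ v : V, ∃ g, (g, v.1) ∈ M := by
    rintro ⟨_, ⟨⟨g, h⟩, hm, rfl⟩⟩
    exact ⟨g, hm⟩
  choose f hf using hV
  refine ⟨U, V, MonoidHom.mk' (fun v => ⟨f v, ⟨_, hf v, rfl⟩⟩) fun v v' => Subtype.ext ?_, ?_, ?_⟩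
  · exact eq_of_k₁_eq_bot hM (hf _) (M.mul_mem (hf v) (hf v'))
  · rintro ⟨_, ⟨⟨g, h⟩, hm, rfl⟩⟩
    exact ⟨⟨h, ⟨_, hm, rfl⟩⟩, Subtype.ext (eq_of_k₁_eq_bot hM (hf _) hm)⟩
  · ext ⟨g, h⟩
    rw [mem_graph]
    constructor
    · rintro ⟨v, hv⟩
      exact hv ▸ hf v
    · intro hm
      have hv : h ∈ V := ⟨_, hm, rfl⟩
      exact ⟨⟨h, hv⟩, Prod.ext (eq_of_k₁_eq_bot hM (hf ⟨h, hv⟩) hm) rfl⟩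

theorem k₁_graph {U : Subgroup G} {V : Subgroup H} (α : V →* U) : k₁ (graph α) = ⊥ := by
  refine (Subgroup.eq_bot_iff_forall _).2 ?_
  rintro g ⟨v, hv⟩
  have e1 : (α v : G) = g := congrArg Prod.fst hv
  have e2 : v = 1 := Subtype.ext (congrArg Prod.snd hv)
  rw [← e1, e2, map_one, Subgroup.coe_one]

theorem k₂_graph {U : Subgroup G} {V : Subgroup H} (α : V →* U) :
    k₂ (graph α) = α.ker.map V.subtype := by
  ext h
  constructor
  · rintro ⟨v, hv⟩
    exact ⟨v, Subtype.ext (congrArg Prod.fst hv), congrArg Prod.snd hv⟩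
  · rintro ⟨v, hv, rfl⟩
    exact ⟨v, Prod.ext (congrArg Subtype.val hv) rfl⟩

theorem compositionLength_ker {U : Subgroup G} {V : Subgroup H} (α : V →* U) :
    compositionLength α.ker = compositionLength (k₂ (graph α)) := by
  rw [k₂_graph]
  exact compositionLength_congr (α.ker.equivMapOfInjective _ V.subtype_injective)

theorem k₂_conj_smul (M : Subgroup (G × H)) (a : G × H) :
    k₂ (MulAut.conj a • M) = MulAut.conj a.2 • k₂ M := by
  ext h
  rw [Subgroup.mem_pointwise_smul_iff_inv_smul_mem, ← map_inv]
  change (1, h) ∈ MulAut.conj a • M ↔ _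
  rw [Subgroup.mem_pointwise_smul_iff_inv_smul_mem, ← map_inv]
  change a⁻¹ * (1, h) * a⁻¹⁻¹ ∈ M ↔ (1, a.2⁻¹ * h * a.2⁻¹⁻¹) ∈ M
  have : a⁻¹ * (1, h) * a⁻¹⁻¹ = (1, a.2⁻¹ * h * a.2⁻¹⁻¹) := by ext <;> simp
  rw [this]

theorem compositionLength_k₂_conj (M : Subgroup (G × H)) (a : G × H) :
    compositionLength (k₂ (MulAut.conj a • M)) = compositionLength (k₂ M) := by
  rw [k₂_conj_smul]
  exact (compositionLength_congr (Subgroup.equivSMul (MulAut.conj a.2) (k₂ M))).symm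

variable [Finite G] [Finite H]

/-- Epimorphisms are traded for left-free subgroups: the graph of `α` is left-free with right kernel
isomorphic to `ker α`, and every left-free subgroup is such a graph. -/
theorem mem_BGraded_iff {T : Set (Subgroup (G × H))} {n : ℕ} {b : B G H} :
    b ∈ BGraded T n ↔ b ∈ BSpan T ∧ ∀ M : Subgroup (G × H), k₁ M = ⊥ →
      compositionLength (k₂ M) ≠ n → B.mark M b = 0 := by
  refine and_congr_right fun _ => ⟨fun h M hM hn => ?_, fun h U V α _ hn => ?_⟩
  · obtain ⟨U, V, α, hα, rfl⟩ := exists_graph_eq hM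
    exact h U V α hα (by rwa [compositionLength_ker])
  · exact h _ (k₁_graph α) (by rwa [← compositionLength_ker])

/-- A nonzero mark occurs only at a conjugate of `M`, and conjugation preserves the length of the
right kernel. -/
theorem gluck_mem_BGraded {T : Set (Subgroup (G × H))}
    (hT : ∀ M ∈ T, ∀ N ≤ M, N ∈ T) {M : Subgroup (G × H)} (hM : M ∈ T) :
    gluck M ∈ BGraded T (compositionLength (k₂ M)) := by
  classical
  have : Fintype (G × H) := Fintype.ofFinite _
  refine mem_BGraded_iff.2 ⟨gluck_mem_BSpan hT M hM, fun K _ hK => ?_⟩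
  rw [mark_gluck]
  refine Finset.sum_eq_zero fun a _ => if_neg ?_
  rintro rfl
  exact hK (compositionLength_k₂_conj K a).symm

end Graph

/-! ### Retractions of algebras along a complementary ideal. -/

section Retraction

/-- A complement of a subalgebra that is an ideal gives a retraction of algebras. -/
theorem exists_retraction {R A D : Type*} [CommRing R] [Ring A] [Ring D] [Algebra R A]
    [Algebra R D] (f : D →ₐ[R] A) (J : Submodule R A) (hl : ∀ a, ∀ j ∈ J, a * j ∈ J)
    (hr : ∀ a, ∀ j ∈ J, j * a ∈ J) (hdisj : ∀ d, f d ∈ J → d = 0)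
    (hspan : ∀ a, ∃ d, a - f d ∈ J) :
    ∃ π : A →ₐ[R] D, (∀ d, π (f d) = d) ∧ ∀ a, π a = 0 ↔ a ∈ J := by
  choose p hp using hspan
  -- The component in `D` is unique, so each algebra-homomorphism law for `p` reduces to a
  -- membership in `J`.
  have huniq : ∀ {a d}, a - f d ∈ J → p a = d := fun {a d} h => by
    refine sub_eq_zero.1 (hdisj _ ?_)
    have := J.sub_mem h (hp a)
    rwa [sub_sub_sub_cancel_left, ← map_sub] at this
  refine ⟨AlgHom.ofLinearMap
    { toFun := p
      map_add' := fun a b => huniq ?_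
      map_smul' := fun r a => huniq ?_ } (huniq ?_) fun a b => huniq ?_, fun d => huniq ?_,
    fun a => ⟨fun h => ?_, fun h => huniq ?_⟩⟩
  · rw [map_add, add_sub_add_comm]
    exact J.add_mem (hp a) (hp b)
  · rw [RingHom.id_apply, map_smul, ← smul_sub]
    exact J.smul_mem r (hp a)
  · rw [map_one, sub_self]
    exact J.zero_mem
  · have : a * b - f (p a * p b) = a * (b - f (p b)) + (a - f (p a)) * f (p b) := by
      rw [map_mul, mul_sub, sub_mul]
      abel
    change a * b - f (p a * p b) ∈ J
    rw [this]
    exact J.add_mem (hl _ _ (hp b)) (hr _ _ (hp a))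
  · rw [sub_self]
    exact J.zero_mem
  · have h' := hp a
    rwa [show p a = 0 from h, map_zero, sub_zero] at h'
  · rwa [map_zero, sub_zero]

end Retraction

/-! ### Simple modules and nil ideals. -/

section Simple

/-- Nilpotent elements of a left ideal annihilate simple modules. -/
theorem smul_eq_zero_of_nil {A : Type w} [Ring A] {M : Type v} [AddCommGroup M] [Module A M]
    [IsSimpleModule A M] {j : A} (hj : ∀ a : A, IsNilpotent (a * j)) (m : M) : j • m = 0 := by
  by_contra h
  -- A nonzero `j • m` generates the module, so some `a * j` fixes `m`, as do all its powers,
  -- against nilpotency.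
  obtain ⟨a, ha⟩ := IsSimpleModule.toSpanSingleton_surjective A h m
  have ha' : (a * j) • m = m := by rw [mul_smul]; exact ha
  obtain ⟨n, hn⟩ := hj a
  have : ∀ k : ℕ, (a * j) ^ k • m = m := by
    intro k
    induction k with
    | zero => rw [pow_zero, one_smul]
    | succ k ih => rw [pow_succ, mul_smul, ha', ih]
  have h0 := this n
  rw [hn, zero_smul] at h0
  exact h (by rw [← h0, smul_zero])

/-- Restriction along a ring homomorphism reaching every scalar up to the annihilator preserves
simplicity. -/
theorem isSimpleModule_restrictScalars {A : Type w} {D : Type x} [Ring A] [Ring D] (f : D →+* A)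
    (M : ModuleCat.{v} A) (hM : IsSimpleModule A M)
    (h : ∀ a : A, ∃ d : D, ∀ m : M, a • m = f d • m) :
    IsSimpleModule D ((ModuleCat.restrictScalars f).obj M) := by
  have hsurj := (isSimpleModule_iff_toSpanSingleton_surjective.1 hM).2
  refine isSimpleModule_iff_toSpanSingleton_surjective.2
    ⟨(isSimpleModule_iff_toSpanSingleton_surjective.1 hM).1, fun m hm n => ?_⟩
  obtain ⟨a, ha⟩ := hsurj m hm n
  obtain ⟨d, hd⟩ := h a
  exact ⟨d, (hd m).symm.trans ha⟩

theorem SimpleClass.mk_eq_mk {A : Type w} [Ring A] {M N : ModuleCat.{v} A}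
    {hM : IsSimpleModule A M} {hN : IsSimpleModule A N} (e : M ≃ₗ[A] N) :
    SimpleClass.mk M hM = SimpleClass.mk N hN :=
  Quotient.sound ⟨e⟩

/-- If `π` is a retraction of `f` whose kernel annihilates all simple modules, then restrictions
along `f` and `π` are inverse bijections between isomorphism classes of simple modules. -/
theorem exists_simpleClass_equiv {A : Type w} {D : Type x} [Ring A] [Ring D] (f : D →+* A)
    (π : A →+* D) (hπ : ∀ d, π (f d) = d)
    (hker : ∀ (M : ModuleCat.{v} A), IsSimpleModule A M → ∀ a, π a = 0 → ∀ m : M, a • m = 0) :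
    ∃ e : SimpleClass.{v} A ≃ SimpleClass.{v} D,
      (∀ (M : ModuleCat.{v} A) (hM : IsSimpleModule A M),
        ∃ hM' : IsSimpleModule D ((ModuleCat.restrictScalars f).obj M),
          e (SimpleClass.mk M hM) = SimpleClass.mk _ hM') ∧
      (∀ (N : ModuleCat.{v} D) (hN : IsSimpleModule D N),
        ∃ hN' : IsSimpleModule A ((ModuleCat.restrictScalars π).obj N),
          e.symm (SimpleClass.mk N hN) = SimpleClass.mk _ hN') := by
  -- `a - f (π a)` lies in the kernel of `π`, hence acts as zero. So the identity map of `M` is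
  -- linear for the structure obtained by restricting along `f` and then along `π`.
  have hact : ∀ (M : ModuleCat.{v} A), IsSimpleModule A M → ∀ (a : A) (m : M),
      a • m = f (π a) • m := by
    intro M hM a m
    rw [← sub_eq_zero, ← sub_smul]
    exact hker M hM _ (by rw [map_sub, hπ, sub_self]) m
  have h1 : ∀ (M : ModuleCat.{v} A) (_ : IsSimpleModule A M),
      IsSimpleModule D ((ModuleCat.restrictScalars f).obj M) := fun M hM =>
    isSimpleModule_restrictScalars f M hM fun a => ⟨π a, hact M hM a⟩
  have h2 : ∀ (N : ModuleCat.{v} D) (_ : IsSimpleModule D N),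
      IsSimpleModule A ((ModuleCat.restrictScalars π).obj N) := fun N hN =>
    isSimpleModule_restrictScalars π N hN fun d => ⟨f d, fun n => by rw [hπ]⟩
  refine ⟨
    { toFun := Quotient.lift (fun M => SimpleClass.mk _ (h1 M.1 M.2)) ?_
      invFun := Quotient.lift (fun N => SimpleClass.mk _ (h2 N.1 N.2)) ?_
      left_inv := ?_
      right_inv := ?_ }, fun M hM => ⟨h1 M hM, rfl⟩, fun N hN => ⟨h2 N hN, rfl⟩⟩
  · rintro ⟨M, hM⟩ ⟨N, hN⟩ ⟨e⟩
    exact SimpleClass.mk_eq_mk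
      { e.toAddEquiv with map_smul' := fun d m => e.map_smul (f d) m }
  · rintro ⟨M, hM⟩ ⟨N, hN⟩ ⟨e⟩
    exact SimpleClass.mk_eq_mk
      { e.toAddEquiv with map_smul' := fun a m => e.map_smul (π a) m }
  · rintro ⟨M, hM⟩
    exact SimpleClass.mk_eq_mk
      { AddEquiv.refl M with map_smul' := fun a m => (hact M hM a m).symm }
  · rintro ⟨N, hN⟩
    refine SimpleClass.mk_eq_mk
      { AddEquiv.refl N with map_smul' := fun d n => ?_ }
    change π (f d) • (show N from n) = d • (show N from n)
    rw [hπ]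

end Simple

theorem isUnit_card_prod {R : Type w} [CommRing R] {G : Type u}
    (hG : IsUnit (Nat.card G : R)) : IsUnit (Nat.card (G × G) : R) := by
  rw [Nat.card_prod, Nat.cast_mul]
  exact hG.mul hG

/-! ### The ideal of positive degree in `RB^S(G, G)`. -/

namespace SubgroupSystem

variable {ι : Type x} {𝓖 : ι → Type u} [∀ i, Group (𝓖 i)] [∀ i, Finite (𝓖 i)]
  (S : SubgroupSystem 𝓖) (R : Type w) [CommRing R] {i : ι}

theorem tmul_mem_RBS {b : B (𝓖 i) (𝓖 i)} (hb : b ∈ BSpan (S.sets i i)) (r : R) :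
    r ⊗ₜ b ∈ S.RBS R i :=
  Subalgebra.tmul_mem_baseChange (R := ℤ) (C := subalgebraOfSubring (S.BSRing i)) hb r

theorem mem_RBS_iff {x : R ⊗[ℤ] B (𝓖 i) (𝓖 i)} :
    x ∈ S.RBS R i ↔ x ∈ RSpan R (S.sets i i) := by
  constructor
  · rintro ⟨x, rfl⟩
    induction x using TensorProduct.induction_on with
    | zero => rw [map_zero]; exact zero_mem _
    | add x y hx hy => rw [map_add]; exact add_mem hx hy
    | tmul r b => exact tmul_mem_RSpan R b.2 r
  · intro hx
    induction hx using Submodule.span_induction with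
    | zero => exact zero_mem _
    | add x y _ _ hx hy => exact add_mem hx hy
    | smul r x _ hx => exact Subalgebra.smul_mem _ hx r
    | mem x hx =>
      obtain ⟨M, hM, rfl⟩ := hx
      exact S.tmul_mem_RBS R (AddSubgroup.subset_closure ⟨M, hM, rfl⟩) 1

theorem RBSn_le (n : ℕ) : S.RBSn R i n ≤ RSpan R (S.sets i i) := by
  rw [RBSn, Submodule.baseChange_eq_span, Submodule.span_le]
  rintro _ ⟨b, hb, rfl⟩
  exact tmul_mem_RSpan R hb.1 1

theorem markR_of_mem_RBSn {n : ℕ} {x : R ⊗[ℤ] B (𝓖 i) (𝓖 i)} (hx : x ∈ S.RBSn R i n)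
    {M : Subgroup (𝓖 i × 𝓖 i)} (hM : k₁ M = ⊥) (hn : compositionLength (k₂ M) ≠ n) :
    markR R M x = 0 := by
  suffices h : S.RBSn R i n ≤ LinearMap.ker (markR R M) from h hx
  rw [RBSn, Submodule.baseChange_eq_span, Submodule.span_le]
  rintro _ ⟨b, hb, rfl⟩
  have h0 := (mem_BGraded_iff.1 hb).2 M hM hn
  change markR R M ((1 : R) ⊗ₜ b) = 0
  rw [markR_tmul, h0, Int.cast_zero, zero_mul]

theorem gluck_mem_RBSn {M : Subgroup (𝓖 i × 𝓖 i)} (hM : M ∈ S.sets i i) :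
    (1 : R) ⊗ₜ gluck M ∈ S.RBSn R i (compositionLength (k₂ M)) :=
  Submodule.tmul_mem_baseChange_of_mem _
    (gluck_mem_BGraded (fun _ hM _ hN => S.mem_of_le hM hN) hM)

variable {R} in
theorem markR_eq_zero_of_notMem {x : R ⊗[ℤ] B (𝓖 i) (𝓖 i)} (hx : x ∈ RSpan R (S.sets i i))
    {M : Subgroup (𝓖 i × 𝓖 i)} (hM : M ∉ S.sets i i) : markR R M x = 0 :=
  markR_eq_zero R (fun _ hM a => S.conj_mem hM a) (fun _ hM _ hN => S.mem_of_le hM hN) hx hM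

variable (i) in
/-- The elements of `RB^S(G, G)` whose marks at twisted diagonal subgroups vanish. -/
noncomputable def twistedKernel : Submodule R (S.RBS R i) where
  carrier := {a | ∀ M ∈ twistedDiagonalSubgroups (𝓖 i) (𝓖 i), markR R M a = 0}
  zero_mem' := fun M _ => map_zero (markR R M)
  add_mem' := fun {a b} ha hb M hM => by
    rw [Subalgebra.coe_add, map_add, ha M hM, hb M hM, add_zero]
  smul_mem' := fun r a ha M hM => by
    rw [Subalgebra.coe_smul, map_smul, ha M hM, smul_zero]

variable {R} {S}

/-- Elements of `RB^S(G, G)` are determined by their marks. -/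
theorem eq_zero_of_markR (hG : IsUnit (Nat.card (𝓖 i) : R)) {x : R ⊗[ℤ] B (𝓖 i) (𝓖 i)}
    (hx : x ∈ RSpan R (S.sets i i)) (h : ∀ M ∈ S.sets i i, markR R M x = 0) : x = 0 := by
  have : Fintype (Subgroup (𝓖 i × 𝓖 i)) := Fintype.ofFinite _
  refine (isUnit_card_prod hG).smul_eq_zero.1 ?_
  rw [card_smul_eq_sum_gluck R (isUnit_card_prod hG) hx]
  refine Finset.sum_eq_zero fun M _ => ?_
  by_cases hM : M ∈ S.sets i i
  · rw [h M hM, zero_smul]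
  · rw [S.markR_eq_zero_of_notMem hx hM, zero_smul]

/-- Each `M` in `S` has a single degree `l(k₂ M)`, so an element lying both in degree `n` and in the
sum of the other degrees has no nonzero mark. -/
theorem iSupIndep_RBSn (hS : S.sets i i ⊆ leftFreeSubgroups (𝓖 i) (𝓖 i))
    (hG : IsUnit (Nat.card (𝓖 i) : R)) : iSupIndep (S.RBSn R i) := by
  refine iSupIndep_def.2 fun n => Submodule.disjoint_def.2 fun x hx hx' => ?_
  refine eq_zero_of_markR hG (S.RBSn_le R n hx) fun M hM => ?_
  by_cases hn : compositionLength (k₂ M) = n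
  · suffices h : ⨆ m, ⨆ (_ : m ≠ n), S.RBSn R i m ≤ LinearMap.ker (markR R M) from h hx'
    refine iSup₂_le fun m hm y hy => ?_
    exact S.markR_of_mem_RBSn R hy (hS hM) (hn ▸ hm.symm)
  · exact S.markR_of_mem_RBSn R hx (hS hM) hn

/-- In the `gluck` expansion of an element of the kernel the twisted diagonal terms drop out, and
`k₂ M ≠ 1` puts every other term in positive degree. Conversely, twisted diagonal subgroups have
degree zero, where marks of elements of positive degree vanish. -/
theorem mem_twistedKernel_iff (hS : S.sets i i ⊆ leftFreeSubgroups (𝓖 i) (𝓖 i))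
    (hG : IsUnit (Nat.card (𝓖 i) : R)) (a : S.RBS R i) :
    a ∈ S.twistedKernel R i ↔
      (a : R ⊗[ℤ] B (𝓖 i) (𝓖 i)) ∈ ⨆ n ≥ 1, S.RBSn R i n := by
  constructor
  · intro ha
    have : Fintype (Subgroup (𝓖 i × 𝓖 i)) := Fintype.ofFinite _
    have hu := isUnit_card_prod hG
    have hx := (S.mem_RBS_iff R).1 a.2
    refine (Submodule.smul_mem_iff_of_isUnit _ hu).1 ?_
    rw [card_smul_eq_sum_gluck R hu hx]
    refine sum_mem fun M _ => ?_
    by_cases hM : M ∈ S.sets i i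
    · by_cases h2 : k₂ M = ⊥
      · rw [ha M ⟨hS hM, h2⟩, zero_smul]
        exact zero_mem _
      · refine Submodule.smul_mem _ _ (Submodule.mem_iSup_of_mem _
          (Submodule.mem_iSup_of_mem (Nat.one_le_iff_ne_zero.2 fun h0 => h2 ?_)
            (S.gluck_mem_RBSn R hM)))
        rw [compositionLength_eq_zero_iff] at h0
        exact (Subgroup.eq_bot_of_subsingleton _)
    · rw [S.markR_eq_zero_of_notMem hx hM, zero_smul]
      exact zero_mem _
  · intro ha M hM
    suffices h : ⨆ n ≥ 1, S.RBSn R i n ≤ LinearMap.ker (markR R M) from h ha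
    refine iSup₂_le fun n hn y hy => S.markR_of_mem_RBSn R hy hM.1 ?_
    have : compositionLength (k₂ M) = 0 := by
      rw [compositionLength_eq_zero_iff, hM.2]
      infer_instance
    omega

/-- Marks of `a` vanish outside `S`, so in the product formula only those `γ` with left-free left
factor need to be checked. -/
theorem markR_mul_eq_zero (hS : S.sets i i ⊆ leftFreeSubgroups (𝓖 i) (𝓖 i))
    (hG : IsUnit (Nat.card (𝓖 i) : R)) (a b : S.RBS R i) {M : Subgroup (𝓖 i × 𝓖 i)}
    (h : ∀ γ : M →* 𝓖 i, k₁ (leftFactor M γ) = ⊥ →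
      markR R (leftFactor M γ) (a : R ⊗[ℤ] B (𝓖 i) (𝓖 i)) *
        markR R (rightFactor M γ) (b : R ⊗[ℤ] B (𝓖 i) (𝓖 i)) = 0) :
    markR R M ((a * b : S.RBS R i) : R ⊗[ℤ] B (𝓖 i) (𝓖 i)) = 0 := by
  have : Finite (M →* 𝓖 i) := Finite.of_injective (fun f : M →* 𝓖 i => (f : M → 𝓖 i))
    DFunLike.coe_injective
  have : Fintype (M →* 𝓖 i) := Fintype.ofFinite _
  have ha := (S.mem_RBS_iff R).1 a.2
  refine hG.mul_right_eq_zero.1 ?_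
  rw [Subalgebra.coe_mul, card_mul_markR_mul R hS ha ((S.mem_RBS_iff R).1 b.2) M]
  refine Finset.sum_eq_zero fun γ _ => ?_
  by_cases hγ : k₁ (leftFactor M γ) = ⊥
  · exact h γ hγ
  · rw [S.markR_eq_zero_of_notMem ha fun hm => hγ (hS hm), zero_mul]

/-- At a twisted diagonal `M`, both factors in every remaining term are twisted diagonal, so either
hypothesis kills the term. -/
theorem mul_mem_twistedKernel (hS : S.sets i i ⊆ leftFreeSubgroups (𝓖 i) (𝓖 i))
    (hG : IsUnit (Nat.card (𝓖 i) : R)) (a b : S.RBS R i)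
    (h : a ∈ S.twistedKernel R i ∨ b ∈ S.twistedKernel R i) : a * b ∈ S.twistedKernel R i := by
  intro M hM
  refine markR_mul_eq_zero hS hG a b fun γ hγ => ?_
  rcases h with h | h
  · rw [h _ ⟨hγ, k₂_leftFactor_eq_bot hM.2 γ⟩, zero_mul]
  · rw [h _ ⟨k₁_rightFactor hM.1 γ, k₂_rightFactor_eq_bot hM.2 hγ⟩, mul_zero]

theorem isNilpotent_of_mem_twistedKernel (hS : S.sets i i ⊆ leftFreeSubgroups (𝓖 i) (𝓖 i))
    (hG : IsUnit (Nat.card (𝓖 i) : R)) {a : S.RBS R i} (ha : a ∈ S.twistedKernel R i) :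
    IsNilpotent a := by
  -- Induction on a bound for `|k₂ M|`, vacuous at `m = 0`. In `a * a ^ m`, the mark of `a` vanishes
  -- if the left factor is twisted diagonal; otherwise the right factor has smaller right kernel and
  -- the mark of `a ^ m` vanishes. The exponent `|G|` then serves for all `M`.
  have key : ∀ (m : ℕ) (M : Subgroup (𝓖 i × 𝓖 i)), k₁ M = ⊥ → Nat.card (k₂ M) ≤ m →
      markR R M ((a ^ m : S.RBS R i) : R ⊗[ℤ] B (𝓖 i) (𝓖 i)) = 0 := by
    intro m
    induction m with
    | zero => exact fun M _ h => absurd h Nat.card_pos.not_ge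
    | succ m ih =>
      intro M hM h
      rw [pow_succ']
      refine markR_mul_eq_zero hS hG a (a ^ m) fun γ hγ => ?_
      by_cases h2 : k₂ (leftFactor M γ) = ⊥
      · rw [ha _ ⟨hγ, h2⟩, zero_mul]
      · rw [ih _ (k₁_rightFactor hM γ)
          (Nat.lt_succ_iff.1 ((card_k₂_rightFactor_lt hγ h2).trans_le h)), mul_zero]
  refine ⟨Nat.card (𝓖 i), Subtype.ext (eq_zero_of_markR hG ((S.mem_RBS_iff R).1 (a ^ _).2)
    fun M hM => key _ M (hS hM) (Subgroup.card_le_card_group _))⟩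

theorem coe_incl (d : S.delta.RBS R i) :
    (S.incl R i d : R ⊗[ℤ] B (𝓖 i) (𝓖 i)) = d :=
  Subalgebra.coe_inclusion _ _

theorem eq_zero_of_incl_mem_twistedKernel (hG : IsUnit (Nat.card (𝓖 i) : R))
    (d : S.delta.RBS R i) (hd : S.incl R i d ∈ S.twistedKernel R i) : d = 0 := by
  have h : (d : R ⊗[ℤ] B (𝓖 i) (𝓖 i)) = 0 := by
    refine eq_zero_of_markR (S := S.delta) hG ((S.delta.mem_RBS_iff R).1 d.2) fun M hM => ?_
    have h := hd M hM.2
    rwa [coe_incl] at h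
  exact (ZeroMemClass.coe_eq_zero).1 h

/-- The element `d` is the part of the `gluck` expansion of `a` indexed by `Δ(S)`, divided by `|G ×
G|`. -/
theorem exists_sub_incl_mem_twistedKernel (hG : IsUnit (Nat.card (𝓖 i) : R)) (a : S.RBS R i) :
    ∃ d, a - S.incl R i d ∈ S.twistedKernel R i := by
  classical
  have : Fintype (Subgroup (𝓖 i × 𝓖 i)) := Fintype.ofFinite _
  have : Fintype (𝓖 i × 𝓖 i) := Fintype.ofFinite _
  obtain ⟨u, hu⟩ := isUnit_card_prod hG
  have hx := (S.mem_RBS_iff R).1 a.2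
  have hsum := card_smul_eq_sum_gluck R ⟨u, hu⟩ hx
  let y : R ⊗[ℤ] B (𝓖 i) (𝓖 i) := ∑ M : Subgroup (𝓖 i × 𝓖 i),
    if M ∈ S.delta.sets i i then markR R M a.1 • ((1 : R) ⊗ₜ[ℤ] gluck M) else 0
  have hy : y ∈ S.delta.RBS R i := by
    refine sum_mem fun M _ => ?_
    split_ifs with hM
    · exact Subalgebra.smul_mem _ (S.delta.tmul_mem_RBS R
        (gluck_mem_BSpan (fun _ hM _ hN => S.delta.mem_of_le hM hN) M hM) 1) _
    · exact zero_mem _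
  refine ⟨(u⁻¹ : Rˣ).1 • ⟨y, hy⟩, fun K hK => ?_⟩
  change markR R K (a.1 - (u⁻¹ : Rˣ).1 • y) = 0
  have e : a.1 - (u⁻¹ : Rˣ).1 • y = (u⁻¹ : Rˣ).1 • ((Nat.card (𝓖 i × 𝓖 i) : R) • a.1 - y) := by
    rw [smul_sub, ← hu, smul_smul, Units.inv_mul, one_smul]
  rw [e, map_smul, hsum, map_sub, map_sum, map_sum, ← Finset.sum_sub_distrib,
    Finset.sum_eq_zero, smul_zero]
  -- The discarded `M` in `S` are not conjugate to the twisted diagonal `K`, so `gluck M` has mark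
  -- zero at `K`; for `M` outside `S` the coefficient itself is zero.
  intro M _
  by_cases hM : M ∈ S.delta.sets i i
  · rw [if_pos hM, sub_self]
  · rw [if_neg hM, map_zero, sub_zero, map_smul]
    by_cases hMS : M ∈ S.sets i i
    · rw [markR_tmul, mark_gluck, Finset.sum_eq_zero, Int.cast_zero, zero_mul, smul_zero]
      refine fun g _ => if_neg ?_
      rintro rfl
      refine hM ⟨hMS, ?_, ?_⟩
      · exact k₁_map_conj hK.1 g
      · rw [k₂_conj_smul, hK.2, Subgroup.smul_bot]
    · rw [S.markR_eq_zero_of_notMem hx hMS, zero_smul]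

theorem exists_retraction_incl (hS : S.sets i i ⊆ leftFreeSubgroups (𝓖 i) (𝓖 i))
    (hG : IsUnit (Nat.card (𝓖 i) : R)) :
    ∃ π : S.RBS R i →ₐ[R] S.delta.RBS R i,
      (∀ d, π (S.incl R i d) = d) ∧ ∀ a, π a = 0 ↔ a ∈ S.twistedKernel R i := by
  refine exists_retraction (A := S.RBS R i) (D := S.delta.RBS R i) (S.incl R i) (S.twistedKernel R i) ?_ ?_ ?_ ?_
  · exact fun a j hj => mul_mem_twistedKernel hS hG a j (Or.inr hj)
  · exact fun a j hj => mul_mem_twistedKernel hS hG j a (Or.inl hj)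
  · exact fun d hd => eq_zero_of_incl_mem_twistedKernel hG d hd
  · exact fun a => exists_sub_incl_mem_twistedKernel hG a

theorem smul_eq_zero_of_mem_twistedKernel (hS : S.sets i i ⊆ leftFreeSubgroups (𝓖 i) (𝓖 i))
    (hG : IsUnit (Nat.card (𝓖 i) : R)) {M : Type v} [AddCommGroup M] [Module (S.RBS R i) M]
    [IsSimpleModule (S.RBS R i) M] {j : S.RBS R i} (hj : j ∈ S.twistedKernel R i) (m : M) :
    j • m = 0 :=
  smul_eq_zero_of_nil (A := S.RBS R i) (fun a => isNilpotent_of_mem_twistedKernel hS hG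
    (mul_mem_twistedKernel hS hG a j (Or.inr hj))) m

end SubgroupSystem

end DoubleBurnside

theorem corollary6p5 {ι : Type x} (𝓖 : ι → Type u) [∀ i, Group (𝓖 i)] [∀ i, Finite (𝓖 i)]
    (S : DoubleBurnside.SubgroupSystem 𝓖)
    (hS : ∀ i j, S.sets i j ⊆ DoubleBurnside.leftFreeSubgroups (𝓖 i) (𝓖 j))
    (R : Type w) [Field R] (i : ι)
    (hG : IsUnit (Nat.card (𝓖 i) : R))
    (hOut : ∀ U : Subgroup (𝓖 i), IsUnit (Nat.card (S.delta.Out i U) : R)) :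
    iSupIndep (S.RBSn R i) ∧
    ∃ π : S.RBS R i →ₐ[R] S.delta.RBS R i,
      (∀ a, π (S.incl R i a) = a) ∧
      (∀ a : S.RBS R i, π a = 0 ↔ (a : R ⊗[ℤ] DoubleBurnside.B (𝓖 i) (𝓖 i)) ∈ ⨆ n ≥ 1, S.RBSn R i n) ∧
      ∃ e : DoubleBurnside.SimpleClass.{v} (S.RBS R i) ≃ DoubleBurnside.SimpleClass.{v} (S.delta.RBS R i),
        (∀ (M : ModuleCat.{v} (S.RBS R i)) (hM : IsSimpleModule (S.RBS R i) M),
          ∃ hM' : IsSimpleModule (S.delta.RBS R i)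
              ((ModuleCat.restrictScalars (S.incl R i).toRingHom).obj M),
            e (DoubleBurnside.SimpleClass.mk M hM) = DoubleBurnside.SimpleClass.mk _ hM') ∧
        (∀ (N : ModuleCat.{v} (S.delta.RBS R i)) (hN : IsSimpleModule (S.delta.RBS R i) N),
          ∃ hN' : IsSimpleModule (S.RBS R i)
              ((ModuleCat.restrictScalars π.toRingHom).obj N),
            e.symm (DoubleBurnside.SimpleClass.mk N hN) = DoubleBurnside.SimpleClass.mk _ hN') := by
  refine ⟨DoubleBurnside.SubgroupSystem.iSupIndep_RBSn (hS i i) hG, ?_⟩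
  obtain ⟨π, hπ, hker⟩ := DoubleBurnside.SubgroupSystem.exists_retraction_incl (hS i i) hG
  have hz : ∀ (M : ModuleCat.{v} (S.RBS R i)), IsSimpleModule (S.RBS R i) M →
      ∀ j : S.RBS R i, π.toRingHom j = 0 → ∀ m : M, j • m = 0 := fun M _ j hj m =>
    DoubleBurnside.SubgroupSystem.smul_eq_zero_of_mem_twistedKernel (hS i i) hG
      ((hker j).1 hj) m
  have he := DoubleBurnside.exists_simpleClass_equiv.{v} (A := S.RBS R i) (D := S.delta.RBS R i)
    (S.incl R i).toRingHom π.toRingHom hπ hz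
  exact ⟨π, hπ, fun a => (hker a).trans
    (DoubleBurnside.SubgroupSystem.mem_twistedKernel_iff (hS i i) hG a), he⟩
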